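/- Let $G=\prod_{k=0}^{\infty}\mathbb{Z}_2$ be the Walsh group with its normalized Haar (product) measure $\mu$, let $I_n(x)=\{y\in G: y_j=x_j \text{ for } 0\le j<n\}$, and let $\zeta_n$ be the $\sigma$-algebra generated by the sets $I_n(x)$, $x\in G$. Let $w_n(x)=(-1)^{\sum_k n_kx_k}$, where $n=\sum_k n_k2^k$ with $n_k\in\{0,1\}$, be the Walsh functions. For a real martingale $F=(F_n)_{n\ge 0}$ with respect to $(\zeta_n)$ put $\widehat F(k)=\lim_{n\to\infty}\int_G F_nw_k\,d\mu$, $S_nF=\sum_{k=0}^{n-1}\widehat F(k)w_k$ and $\sigma_nF=\frac1n\sum_{k=1}^nS_kF$ for $n\ge1$. Let $\|f\|_{1/2}=\left(\int_G|f|^{1/2}\,d\mu\right)^{2}$, and let $H_{1/2}(G)$ be the space of all such martingales with $\|F\|_{H_{1/2}}:=\left\|\sup_{n\ge 0}|F_n|\right\|_{1/2}<\infty$. (a) The maximal operator $\tilde\sigma^*F:=\sup_{n\ge1}\frac{|\sigma_nF|}{\log^2(n+1)}$ is bounded from $H_{1/2}(G)$ to $L_{1/2}(G)$: there is an absolute constant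 $C$ such that $\tilde\sigma^*F\in L_{1/2}(G)$ and $\|\tilde\sigma^*F\|_{1/2}\le C\|F\|_{H_{1/2}}$ for all $F\in H_{1/2}(G)$. (b) Let $(\varphi_n)$ be a nondecreasing sequence of real numbers, positive for $n\ge1$, such that $\lim_{n\to\infty}\frac{\log^2(n+1)}{\varphi_n}=+\infty$. Then the maximal operator $F\mapsto\sup_{n\ge1}\frac{|\sigma_nF|}{\varphi_n}$ is not bounded from $H_{1/2}(G)$ to $L_{1/2}(G)$; indeed there is a martingale $F\in H_{1/2}(G)$ such that $\left\|\sup_{n\ge1}\frac{|\sigma_nF|}{\varphi_n}\right\|_{1/2}=\infty$. -/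

import Mathlib

open MeasureTheory Filter
open scoped ENNReal

namespace WalshFejer

/-- The Walsh group: the complete direct product of countably many copies of `Z₂`,
with the product σ-algebra of the discrete factors. -/
abbrev G : Type := ℕ → ZMod 2

/-- The measure on `Z₂` for which each singleton has measure `1/2`. -/
noncomputable def coinMeasure : Measure (ZMod 2) := ProbabilityTheory.uniformOn Set.univ

instance : IsProbabilityMeasure coinMeasure := by
  unfold coinMeasure
  infer_instance

/-- The normalized Haar measure of `G`, i.e. the product measure. -/
noncomputable def μ : Measure G := Measure.infinitePi fun _ : ℕ => coinMeasure

instance : IsProbabilityMeasure μ := by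
  unfold μ
  infer_instance

/-- The dyadic interval `I_n(x)`. -/
def interval (n : ℕ) (x : G) : Set G := {y | ∀ j < n, y j = x j}

/-- The family of dyadic intervals of order `n`. -/
def intervals (n : ℕ) : Set (Set G) := Set.range (interval n)

theorem measurableSet_interval (n : ℕ) (x : G) : MeasurableSet (interval n x) := by
  have h : interval n x = ⋂ j ∈ Set.Iio n, (fun y : G => y j) ⁻¹' {x j} := by
    ext y
    simp [interval]
  rw [h]
  exact MeasurableSet.biInter (Set.to_countable _) fun j _ =>
    measurable_pi_apply j (MeasurableSet.of_discrete)

theorem interval_eq_union (n : ℕ) (x : G) :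
    interval n x =
      interval (n + 1) x ∪ interval (n + 1) (Function.update x n (x n + 1)) := by
  have key : ∀ a b : ZMod 2, a = b ∨ a = b + 1 := by decide
  ext y
  constructor
  · intro h
    rcases key (y n) (x n) with hn | hn
    · left
      intro j hj
      rcases Nat.lt_succ_iff_lt_or_eq.mp hj with h1 | h1
      · exact h j h1
      · exact h1 ▸ hn
    · right
      intro j hj
      rcases Nat.lt_succ_iff_lt_or_eq.mp hj with h1 | h1
      · rw [Function.update_of_ne h1.ne]
        exact h j h1
      · subst h1
        rw [Function.update_self]
        exact hn
  · rintro (h | h) j hj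
    · exact h j (Nat.lt_succ_of_lt hj)
    · have := h j (Nat.lt_succ_of_lt hj)
      rwa [Function.update_of_ne hj.ne] at this

/-- The filtration `(ζ_n)`: `ζ_n` is generated by the dyadic intervals of order `n`. -/
def ζ : Filtration ℕ (inferInstance : MeasurableSpace G) where
  seq n := MeasurableSpace.generateFrom (intervals n)
  mono' := monotone_nat_of_le_succ fun n => by
    refine MeasurableSpace.generateFrom_le ?_
    rintro _ ⟨x, rfl⟩
    rw [interval_eq_union]
    exact MeasurableSet.union (MeasurableSpace.measurableSet_generateFrom (Set.mem_range_self x))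
      (MeasurableSpace.measurableSet_generateFrom (Set.mem_range_self _))
  le' n := by
    refine MeasurableSpace.generateFrom_le ?_
    rintro _ ⟨x, rfl⟩
    exact measurableSet_interval n x

/-- The Rademacher functions `r_k(x) = (-1)^{x_k}`. -/
def rademacher (k : ℕ) (x : G) : ℝ := (-1) ^ (x k).val

/-- The Walsh functions `w_n = ∏_k r_k^{n_k}`, where `n_k` are the binary digits of `n`
(all of them with index `k ≥ n` vanish). -/
def walsh (n : ℕ) (x : G) : ℝ :=
  ∏ k ∈ Finset.range n, rademacher k x ^ (n.testBit k).toNat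

/-- The maximal function `F^* = sup_n |F_n|`. -/
noncomputable def maximalFunction (F : ℕ → G → ℝ) (x : G) : ℝ≥0∞ :=
  ⨆ n, ENNReal.ofReal |F n x|

/-- The quasi-norm `‖F‖_{H_p} = ‖F^*‖_p`, with value `∞` allowed. -/
noncomputable def hardyNorm (p : ℝ≥0∞) (F : ℕ → G → ℝ) : ℝ≥0∞ :=
  eLpNorm (maximalFunction F) p μ

/-- The martingale Hardy space `H_p(G)`. -/
def hardySpace (p : ℝ≥0∞) : Set (ℕ → G → ℝ) :=
  {F | Martingale F ζ μ ∧ hardyNorm p F < ∞}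

/-- The `k`-th Walsh–Fourier coefficient of a martingale. -/
noncomputable def fourierCoeff (F : ℕ → G → ℝ) (k : ℕ) : ℝ :=
  limUnder atTop fun n => ∫ x, F n x * walsh k x ∂μ

/-- The partial sums `S_n F = ∑_{k < n} F̂(k) w_k`. -/
noncomputable def partialSum (n : ℕ) (F : ℕ → G → ℝ) (x : G) : ℝ :=
  ∑ k ∈ Finset.range n, fourierCoeff F k * walsh k x

/-- The Fejér means `σ_n F = (1/n) ∑_{k=1}^n S_k F` (used for `n ≥ 1`). -/
noncomputable def fejerMean (n : ℕ) (F : ℕ → G → ℝ) (x : G) : ℝ :=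
  1 / (n : ℝ) * ∑ k ∈ Finset.Icc 1 n, partialSum k F x

/-- The weighted maximal operator `sup_{n ≥ 1} |σ_n F| / φ_n` (for weights that are positive
at every `n ≥ 1`). -/
noncomputable def weightedMaximal (φ : ℕ → ℝ) (F : ℕ → G → ℝ) (x : G) : ℝ≥0∞ :=
  ⨆ n ≥ 1, ENNReal.ofReal (|fejerMean n F x| / φ n)

/-- Boundedness of an operator from `H_p(G)` to `L_p(G)`. -/
def BoundedHardyToLp (p : ℝ≥0∞) (T : (ℕ → G → ℝ) → G → ℝ≥0∞) : Prop :=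
  ∃ C : NNReal, ∀ F ∈ hardySpace p,
    MemLp (T F) p μ ∧ eLpNorm (T F) p μ ≤ C * hardyNorm p F

theorem walsh_eq_of_mem_interval {n k : ℕ} (h : k < 2 ^ n) {x y : G} (hy : y ∈ interval n x) :
    walsh k y = walsh k x := by
  refine Finset.prod_congr rfl fun j _ => ?_
  by_cases hj : j < n
  · simp only [rademacher, hy j hj]
  · have h1 : k.testBit j = false :=
      Nat.testBit_lt_two_pow (h.trans_le (Nat.pow_le_pow_right two_pos (not_lt.mp hj)))
    simp [h1]

theorem stronglyMeasurable_walsh {n k : ℕ} (h : k < 2 ^ n) :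
    StronglyMeasurable[ζ n] (walsh k) := by
  refine Measurable.stronglyMeasurable ?_
  intro s _
  let e : (Fin n → ZMod 2) → G := fun a j => if hj : j < n then a ⟨j, hj⟩ else 0
  have : walsh k ⁻¹' s = ⋃ a ∈ {a : Fin n → ZMod 2 | walsh k (e a) ∈ s}, interval n (e a) := by
    ext x
    simp only [Set.mem_preimage, Set.mem_iUnion, Set.mem_ofPred_eq, exists_prop]
    constructor
    · intro hx
      have hm : x ∈ interval n (e fun j => x j) := by
        intro j hj
        simp [e, hj]
      exact ⟨fun j => x j, by rwa [← walsh_eq_of_mem_interval h hm], hm⟩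
    · rintro ⟨a, ha, hm⟩
      rwa [walsh_eq_of_mem_interval h hm]
  rw [this]
  exact MeasurableSet.biUnion (Set.to_countable _) fun a _ =>
    MeasurableSpace.measurableSet_generateFrom ⟨_, rfl⟩

theorem abs_walsh (k : ℕ) (x : G) : |walsh k x| = 1 := by
  simp [walsh, rademacher, Finset.abs_prod, abs_pow]

/-- The limit defining the Walsh–Fourier coefficients of a martingale exists. -/
theorem tendsto_fourierCoeff {F : ℕ → G → ℝ} (hF : Martingale F ζ μ) (k : ℕ) :
    Tendsto (fun n => ∫ x, F n x * walsh k x ∂μ) atTop (nhds (fourierCoeff F k)) := by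
  have key : ∀ n ≥ k, ∫ x, F n x * walsh k x ∂μ = ∫ x, F k x * walsh k x ∂μ := by
    intro n hn
    have hw := stronglyMeasurable_walsh (Nat.lt_two_pow_self (n := k))
    have hint : Integrable (F n * walsh k) μ :=
      (hF.integrable n).mul_bdd (c := 1) (hw.mono (ζ.le k)).aestronglyMeasurable
        (Eventually.of_forall fun x => (abs_walsh k x).le)
    have h1 : μ[F n * walsh k | ζ k] =ᵐ[μ] F k * walsh k :=
      (condExp_mul_of_stronglyMeasurable_right hw hint (hF.integrable n)).trans
        ((hF.2 k n hn).mul (EventuallyEq.refl _ _))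
    have h2 := integral_condExp (μ := μ) (f := F n * walsh k) (ζ.le k)
    rw [integral_congr_ae h1] at h2
    exact h2.symm
  have hlim : Tendsto (fun n => ∫ x, F n x * walsh k x ∂μ) atTop
      (nhds (∫ x, F k x * walsh k x ∂μ)) :=
    tendsto_const_nhds.congr' ((eventually_ge_atTop k).mono fun n hn => (key n hn).symm)
  exact tendsto_nhds_limUnder ⟨_, hlim⟩

end WalshFejer

/-! (a) Since `√` is subadditive, the integral of `sqrtMaximal`, the square root of the weighted
maximal operator, is subadditive in the function, so it suffices to treat atoms and add up. For the
kernel, peeling off binary digits bounds `n K_n` by dyadic pieces `majorant B`, which put height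
`2^(B+k)` on the interval of order `B` around `e_k` (`abs_fejerSum_le`). For an atom of height `c`
on an interval of order `M`, the means with `n ≤ 2^M` vanish. For larger `n` and off the interval,
the square root of the mean is at most a constant times `√c * 2^(-M)` times a function whose
integral is `O(M)`: each of the `M + 1` scales contributes `O(1)`. The weight `log (n+1) ≥ M log 2`
cancels exactly this factor `M`, leaving `O(√c * 2^(-M))` (`lintegral_sqrtMaximal_atom_le`).

Atoms come from stopping `F` when a predictable running maximum passes the levels `4^k s^2`. The
difference of consecutive stopped martingales splits over the intervals where the lower level is
first exceeded; these have total measure at most `2 μ{F^* > 4^k s^2}`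
(`sum_measure_firstExceeds_le`). Summing `2^k s` over the levels below `F^*` gives at most `2 √F^*`
(`sum_levels_le`), and `s → 0` followed by Fatou in the martingale index finishes the bound.

(b) Take `F = ∑ b_n (D_{2^{n+1}} - D_{2^n})` with lacunary `b`. The mean of order `2^n + 2^(k+1)`,
`k < n`, contains `b_n K` with unnormalized kernel value exactly `4^k` on the interval of order
`k+1` around `e_k`. After the square root each of these `n` disjoint intervals contributes the same
amount, so the integral grows like `n / √φ(2^(n+1))` times a factor from `b_n`
(`lintegral_weightedMaximal_ge`). This is unbounded by hypothesis. The coefficients `2^(ν_k) / 4^k`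
keep `F` in the Hardy space, while `ν_(k+1)` is chosen so late that it beats both `4^(k+1)` and the
error from the earlier blocks. -/

namespace WalshFejer

/-! ### Translations, Haar measure and dyadic intervals -/

/-- The unit vector of the Walsh group with a one in the coordinate `k`. -/
def unitVec (k : ℕ) : G := Pi.single k 1

theorem unitVec_self (k : ℕ) : unitVec k k = 1 := by simp [unitVec]

theorem unitVec_of_ne {k j : ℕ} (h : j ≠ k) : unitVec k j = 0 := by simp [unitVec, h]

theorem add_self_G (x : G) : x + x = 0 := by
  funext j
  have : ∀ a : ZMod 2, a + a = 0 := by decide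
  exact this _

theorem coinMeasure_apply (s : Set (ZMod 2)) :
    coinMeasure s = Measure.count s / 2 := by
  rw [coinMeasure, ProbabilityTheory.uniformOn_univ]
  simp

theorem map_add_coinMeasure (c : ZMod 2) : coinMeasure.map (fun a => a + c) = coinMeasure := by
  ext s hs
  rw [Measure.map_apply .of_discrete hs, coinMeasure_apply, coinMeasure_apply]
  congr 1
  have h : (fun a : ZMod 2 => a + c) ⁻¹' s = (Equiv.addRight c) ⁻¹' s := rfl
  rw [h, ← Measure.count_injective_image (Equiv.addRight c).injective, Equiv.image_preimage]

theorem measurable_add_const_G (c : G) : Measurable fun x : G => x + c :=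
  measurable_pi_lambda _ fun j =>
    (Measurable.of_discrete (f := fun a : ZMod 2 => a + c j)).comp (measurable_pi_apply j)

theorem measurePreserving_add_const (c : G) : MeasurePreserving (fun x : G => x + c) μ μ := by
  refine ⟨measurable_add_const_G c, ?_⟩
  have h := Measure.infinitePi_map_pi (μ := fun _ : ℕ => coinMeasure)
    (f := fun j a => a + c j) (fun _ => .of_discrete)
  simp only [map_add_coinMeasure] at h
  exact h

/-- Translation by `c` as a measurable equivalence. -/
def addConstEquiv (c : G) : G ≃ᵐ G where
  toEquiv := Equiv.addRight c
  measurable_toFun := measurable_add_const_G c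
  measurable_invFun := measurable_add_const_G (-c)

theorem integral_add_const (c : G) (f : G → ℝ) : ∫ x, f (x + c) ∂μ = ∫ x, f x ∂μ :=
  (measurePreserving_add_const c).integral_comp (addConstEquiv c).measurableEmbedding f

/-- Translation invariance of `μ`. With `c = unitVec j` this is the source of every cancellation
below: mean-zero atoms, the martingale property, orthogonality of Walsh blocks. -/
theorem integral_eq_zero_of_antisymm (c : G) {f : G → ℝ} (h : ∀ x, f (x + c) = -f x) :
    ∫ x, f x ∂μ = 0 := by
  have h1 := integral_add_const c f
  simp only [h, integral_neg] at h1
  linarith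

theorem interval_eq_pi (n : ℕ) (x : G) :
    interval n x = Set.pi (Finset.range n) fun j => {x j} := by
  ext y
  simp [interval]

theorem measure_interval (n : ℕ) (x : G) : μ (interval n x) = 2⁻¹ ^ n := by
  rw [interval_eq_pi, μ, Measure.infinitePi_pi _ (fun _ _ => .of_discrete)]
  simp [coinMeasure_apply]

theorem real_interval (n : ℕ) (x : G) : μ.real (interval n x) = (2 ^ n)⁻¹ := by
  simp [Measure.real, measure_interval]

theorem mem_interval_comm {n : ℕ} {x y : G} : y ∈ interval n x ↔ x ∈ interval n y :=
  ⟨fun h j hj => (h j hj).symm, fun h j hj => (h j hj).symm⟩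

theorem interval_eq_of_mem {n : ℕ} {x y : G} (h : y ∈ interval n x) :
    interval n y = interval n x := by
  ext z
  exact ⟨fun hz j hj => (hz j hj).trans (h j hj), fun hz j hj => (hz j hj).trans (h j hj).symm⟩

theorem interval_anti {m n : ℕ} (h : m ≤ n) (x : G) : interval n x ⊆ interval m x :=
  fun _ hy j hj => hy j (hj.trans_le h)

theorem add_mem_interval {n : ℕ} {x y : G} (h : y ∈ interval n x) (c : G) :
    y + c ∈ interval n (x + c) := fun j hj => by simp [h j hj]

theorem add_mem_interval_iff {n : ℕ} {x y c : G} :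
    y + c ∈ interval n x ↔ y ∈ interval n (x + c) := by
  constructor <;> intro h
  · have := add_mem_interval h c
    rwa [add_assoc, add_self_G, add_zero] at this
  · have := add_mem_interval h c
    rwa [add_assoc, add_self_G, add_zero] at this

theorem add_unitVec_mem_interval {n k : ℕ} (h : n ≤ k) (x : G) :
    x + unitVec k ∈ interval n x := fun j hj => by
  simp [unitVec_of_ne (show j ≠ k by omega)]

theorem mem_interval_succ_or {n : ℕ} {x y : G} (h : y ∈ interval n x) :
    y ∈ interval (n + 1) x ∨ y ∈ interval (n + 1) (x + unitVec n) := by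
  have key : ∀ a b : ZMod 2, a = b ∨ a = b + 1 := by decide
  rcases key (y n) (x n) with hn | hn
  · left
    intro j hj
    rcases Nat.lt_succ_iff_lt_or_eq.mp hj with h1 | rfl
    exacts [h j h1, hn]
  · right
    intro j hj
    rcases Nat.lt_succ_iff_lt_or_eq.mp hj with h1 | rfl
    · simpa [unitVec_of_ne h1.ne] using h j h1
    · simpa [unitVec_self] using hn

theorem mem_interval_succ_iff {n : ℕ} {x y : G} :
    y ∈ interval (n + 1) x ↔ y ∈ interval n x ∧ y n = x n := by
  simp only [interval, Set.mem_ofPred_eq, Nat.lt_succ_iff_lt_or_eq]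
  exact ⟨fun h => ⟨fun j hj => h j (Or.inl hj), h n (Or.inr rfl)⟩,
    fun h j hj => hj.elim (h.1 j) fun e => e ▸ h.2⟩

theorem disjoint_interval_succ (n : ℕ) (x : G) :
    Disjoint (interval (n + 1) x) (interval (n + 1) (x + unitVec n)) := by
  rw [Set.disjoint_left]
  intro y h1 h2
  have a := h1 n n.lt_succ_self
  have b := h2 n n.lt_succ_self
  rw [a] at b
  simp [unitVec_self] at b

/-- The generators of `ζ n` partition `G`, so no set of `ζ n` can separate two points of one
interval. This turns measurability into constancy on intervals. -/
theorem interval_subset_of_measurableSet {n : ℕ} {s : Set G} (hs : MeasurableSet[ζ n] s) {x y : G}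
    (hy : y ∈ interval n x) : x ∈ s ↔ y ∈ s := by
  have hs' : MeasurableSpace.GenerateMeasurable (intervals n) s := hs
  induction hs' with
  | basic u hu =>
    obtain ⟨z, rfl⟩ := hu
    rw [mem_interval_comm (y := x), mem_interval_comm (y := y), interval_eq_of_mem hy]
  | empty => simp
  | compl t ht ih => exact not_congr (ih ht)
  | iUnion f hf ih => simp only [Set.mem_iUnion]; exact exists_congr fun i => ih i (hf i)

theorem eq_of_mem_interval_of_stronglyMeasurable {n : ℕ} {f : G → ℝ}
    (hf : StronglyMeasurable[ζ n] f) {x y : G} (hy : y ∈ interval n x) : f y = f x := by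
  have h := hf.measurable (measurableSet_singleton (f x))
  exact (interval_subset_of_measurableSet h hy).mp rfl

/-- The dyadic representative with prescribed first `n` coordinates. -/
def rep (n : ℕ) (a : Fin n → ZMod 2) : G := fun j => if hj : j < n then a ⟨j, hj⟩ else 0

theorem mem_interval_rep {n : ℕ} {x : G} {a : Fin n → ZMod 2} :
    x ∈ interval n (rep n a) ↔ a = fun j : Fin n => x j := by
  constructor
  · intro h
    funext j
    simpa [rep] using (h j j.2).symm
  · rintro rfl j hj
    simp [rep, hj]

theorem measurable_of_const_on_interval {n : ℕ} {f : G → ℝ}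
    (hf : ∀ x, ∀ y ∈ interval n x, f y = f x) : Measurable[ζ n] f := by
  intro s _
  have : f ⁻¹' s = ⋃ a ∈ {a : Fin n → ZMod 2 | f (rep n a) ∈ s}, interval n (rep n a) := by
    ext x
    simp only [Set.mem_preimage, Set.mem_iUnion, Set.mem_ofPred_eq, exists_prop]
    constructor
    · intro hx
      have hm : x ∈ interval n (rep n fun j => x j) := mem_interval_rep.mpr rfl
      exact ⟨fun j => x j, by rwa [← hf _ _ hm], hm⟩
    · rintro ⟨a, ha, hm⟩
      rwa [hf _ _ hm]
  rw [this]
  exact MeasurableSet.biUnion (Set.to_countable _) fun a _ =>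
    MeasurableSpace.measurableSet_generateFrom ⟨_, rfl⟩

theorem exists_bound_of_const_on_interval {n : ℕ} {f : G → ℝ}
    (hf : ∀ x, ∀ y ∈ interval n x, f y = f x) : ∃ C, ∀ x, |f x| ≤ C := by
  obtain ⟨C, hC⟩ := (Set.finite_range fun a : Fin n → ZMod 2 => |f (rep n a)|).bddAbove
  refine ⟨C, fun x => ?_⟩
  rw [hf (rep n fun j => x j) x (mem_interval_rep.mpr rfl)]
  exact hC ⟨_, rfl⟩

theorem integrable_of_const_on_interval {n : ℕ} {f : G → ℝ}
    (hf : ∀ x, ∀ y ∈ interval n x, f y = f x) : Integrable f μ := by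
  obtain ⟨C, hC⟩ := exists_bound_of_const_on_interval hf
  exact Integrable.of_bound
    ((measurable_of_const_on_interval hf).mono (ζ.le n) le_rfl).aestronglyMeasurable C
    (Eventually.of_forall hC)

/-! ### Walsh functions and kernels -/

theorem rademacher_add (k : ℕ) (x y : G) :
    rademacher k (x + y) = rademacher k x * rademacher k y := by
  have h : ∀ a b : ZMod 2, (-1 : ℤ) ^ (a + b).val = (-1) ^ a.val * (-1) ^ b.val := by decide
  simp only [rademacher, Pi.add_apply]
  exact_mod_cast congrArg (Int.cast : ℤ → ℝ) (h (x k) (y k))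

theorem walsh_add (n : ℕ) (x y : G) : walsh n (x + y) = walsh n x * walsh n y := by
  simp only [walsh, rademacher_add, mul_pow, Finset.prod_mul_distrib]

theorem rademacher_eq_one_or (k : ℕ) (x : G) :
    (x k = 0 ∧ rademacher k x = 1) ∨ (x k = 1 ∧ rademacher k x = -1) := by
  have h : ∀ a : ZMod 2, (a = 0 ∧ a.val = 0) ∨ (a = 1 ∧ a.val = 1) := by decide
  rcases h (x k) with ⟨h1, h2⟩ | ⟨h1, h2⟩
  · left; simp [rademacher, h1]
  · right; simp only [rademacher, h2]; simp [h1]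

theorem abs_rademacher (k : ℕ) (x : G) : |rademacher k x| = 1 := by simp [rademacher, abs_pow]

theorem walsh_eq_prod {n N : ℕ} (h : n < 2 ^ N) (x : G) :
    walsh n x = ∏ k ∈ Finset.range N, rademacher k x ^ (n.testBit k).toNat := by
  have key : ∀ M, n < 2 ^ M → ∀ M', M ≤ M' →
      ∏ k ∈ Finset.range M', rademacher k x ^ (n.testBit k).toNat =
        ∏ k ∈ Finset.range M, rademacher k x ^ (n.testBit k).toNat := by
    intro M hM M' hM'
    symm
    refine Finset.prod_subset (Finset.range_mono hM') fun k _ hk => ?_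
    rw [Nat.testBit_lt_two_pow (hM.trans_le (Nat.pow_le_pow_right two_pos (by simpa using hk)))]
    simp
  rcases le_total n N with h1 | h1
  · exact (key n Nat.lt_two_pow_self N h1).symm
  · exact key N h n h1

theorem walsh_two_pow_add {A i : ℕ} (h : i < 2 ^ A) (x : G) :
    walsh (2 ^ A + i) x = rademacher A x * walsh i x := by
  rw [walsh_eq_prod (N := A + 1) (by rw [pow_succ]; omega), walsh_eq_prod h,
    Finset.prod_range_succ, mul_comm]
  congr 1
  · simp [Nat.testBit_two_pow_add_eq, Nat.testBit_lt_two_pow h]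
  · refine Finset.prod_congr rfl fun k hk => ?_
    rw [Nat.testBit_two_pow_add_gt (Finset.mem_range.mp hk)]

theorem walsh_zero (x : G) : walsh 0 x = 1 := by simp [walsh]

theorem measurable_walsh (k : ℕ) : Measurable (walsh k) :=
  ((stronglyMeasurable_walsh (Nat.lt_two_pow_self (n := k))).mono (ζ.le k)).measurable

/-- The Walsh-Dirichlet kernel. -/
noncomputable def dirichlet (n : ℕ) (x : G) : ℝ := ∑ i ∈ Finset.range n, walsh i x

/-- The sum `D_1 + ⋯ + D_n` of Dirichlet kernels, i.e. `n` times the Fejér kernel. -/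
noncomputable def fejerSum (n : ℕ) (x : G) : ℝ := ∑ k ∈ Finset.range n, dirichlet (k + 1) x

theorem abs_dirichlet_le (n : ℕ) (x : G) : |dirichlet n x| ≤ n := by
  refine (Finset.abs_sum_le_sum_abs _ _).trans ?_
  simp [abs_walsh]

theorem dirichlet_two_pow_add {A j : ℕ} (h : j ≤ 2 ^ A) (x : G) :
    dirichlet (2 ^ A + j) x = dirichlet (2 ^ A) x + rademacher A x * dirichlet j x := by
  rw [dirichlet, Finset.sum_range_add, dirichlet, dirichlet, Finset.mul_sum]
  congr 1
  exact Finset.sum_congr rfl fun i hi =>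
    walsh_two_pow_add ((Finset.mem_range.mp hi).trans_le h) x

open Classical in
theorem dirichlet_two_pow (A : ℕ) (x : G) :
    dirichlet (2 ^ A) x = if x ∈ interval A 0 then 2 ^ A else 0 := by
  induction A with
  | zero => simp [dirichlet, walsh_zero, interval]
  | succ A ih =>
    have hmem : x ∈ interval (A + 1) 0 ↔ x ∈ interval A 0 ∧ x A = 0 := mem_interval_succ_iff
    rw [pow_succ, mul_two, dirichlet_two_pow_add le_rfl, ih]
    rcases rademacher_eq_one_or A x with ⟨h1, h2⟩ | ⟨h1, h2⟩
    · simp only [hmem, h1, h2, and_true]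
      split_ifs <;> ring
    · simp only [hmem, h1, h2, one_ne_zero, and_false, if_false]
      split_ifs <;> ring

/-- Splitting off the top binary digit; this recursion drives all kernel estimates. -/
theorem fejerSum_two_pow_add {A m : ℕ} (h : m ≤ 2 ^ A) (x : G) :
    fejerSum (2 ^ A + m) x =
      fejerSum (2 ^ A) x + m * dirichlet (2 ^ A) x + rademacher A x * fejerSum m x := by
  rw [fejerSum, Finset.sum_range_add, add_assoc]
  congr 1
  rw [fejerSum, Finset.mul_sum, ← nsmul_eq_mul, ← Finset.card_range m, ← Finset.sum_const,
    Finset.card_range, ← Finset.sum_add_distrib]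
  refine Finset.sum_congr rfl fun i hi => ?_
  rw [add_assoc, dirichlet_two_pow_add]
  have := Finset.mem_range.mp hi
  omega

theorem fejerSum_two_pow_succ (A : ℕ) (x : G) :
    fejerSum (2 ^ (A + 1)) x =
      (1 + rademacher A x) * fejerSum (2 ^ A) x + 2 ^ A * dirichlet (2 ^ A) x := by
  rw [pow_succ, mul_two, fejerSum_two_pow_add le_rfl]
  push_cast
  ring

open Classical in
/-- The sum `∑_{k ≤ B} 2^{B+k} 1[x + e_k ∈ I_B(z)]`. -/
noncomputable def majorant (B : ℕ) (z x : G) : ℝ :=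
  ∑ k ∈ Finset.range (B + 1), if x + unitVec k ∈ interval B z then (2 : ℝ) ^ (B + k) else 0

theorem majorant_nonneg (B : ℕ) (z x : G) : 0 ≤ majorant B z x :=
  Finset.sum_nonneg fun k _ => by split_ifs <;> positivity

theorem two_pow_mul_dirichlet_le_majorant (B : ℕ) (x : G) :
    2 ^ B * dirichlet (2 ^ B) x ≤ majorant B 0 x := by
  classical
  rw [dirichlet_two_pow]
  split_ifs with h
  · have h1 : x + unitVec B ∈ interval B 0 := by
      have := add_unitVec_mem_interval le_rfl x (n := B)
      rwa [interval_eq_of_mem h] at this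
    have := Finset.single_le_sum (f := fun k => if x + unitVec k ∈ interval B 0 then
      (2 : ℝ) ^ (B + k) else 0) (s := Finset.range (B + 1)) (fun k _ => by split_ifs <;> positivity)
      (Finset.self_mem_range_succ B)
    simp only [h1, if_true] at this
    rw [← pow_add]
    exact this
  · simpa using majorant_nonneg B 0 x

theorem fejerSum_two_pow_nonneg (B : ℕ) (x : G) : 0 ≤ fejerSum (2 ^ B) x := by
  classical
  induction B with
  | zero => simp [fejerSum, dirichlet, walsh_zero]
  | succ B ih =>
    rw [fejerSum_two_pow_succ, dirichlet_two_pow]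
    have : 0 ≤ 1 + rademacher B x := by
      rcases rademacher_eq_one_or B x with ⟨-, h⟩ | ⟨-, h⟩ <;> rw [h] <;> norm_num
    split_ifs <;> positivity

/-- Induction on the doubling recursion. If `x B = 0`, the pieces with `k < B` double exactly and
the piece `k = B + 1`, of height `4 * 4^B` on `I_(B+1)(0)`, pays for the `3 * 4^B` produced there.
If `x B = 1`, the factor `1 + r_B` vanishes and the remaining `4^B` is covered by the piece `k = B`,
since adding `e_B` corrects the wrong digit. -/
theorem fejerSum_two_pow_le_majorant (B : ℕ) (x : G) :
    fejerSum (2 ^ B) x ≤ majorant B 0 x := by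
  classical
  induction B with
  | zero => simp [fejerSum, dirichlet, walsh_zero, majorant, interval]
  | succ B ih =>
    rw [fejerSum_two_pow_succ]
    rw [majorant, Finset.sum_range_succ, Finset.sum_range_succ] at *
    have hB1 : x + unitVec (B + 1) ∈ interval (B + 1) 0 ↔ x ∈ interval (B + 1) 0 := by
      rw [mem_interval_comm, interval_eq_of_mem (add_unitVec_mem_interval le_rfl x),
        mem_interval_comm]
    have hB0 : x + unitVec B ∈ interval (B + 1) 0 ↔ x ∈ interval B 0 ∧ x B = 1 := by
      rw [mem_interval_succ_iff, mem_interval_comm,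
        interval_eq_of_mem (add_unitVec_mem_interval le_rfl x), mem_interval_comm]
      have : ∀ a : ZMod 2, a + 1 = 0 ↔ a = 1 := by decide
      simp [unitVec_self, this]
    have hB2 : x + unitVec B ∈ interval B 0 ↔ x ∈ interval B 0 := by
      rw [mem_interval_comm,
        interval_eq_of_mem (add_unitVec_mem_interval le_rfl x), mem_interval_comm]
    rw [hB1, hB0, dirichlet_two_pow]
    rw [hB2] at ih
    rcases rademacher_eq_one_or B x with ⟨h1, h2⟩ | ⟨h1, h2⟩
    · have hs : ∑ k ∈ Finset.range B, (if x + unitVec k ∈ interval (B + 1) 0 then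
          (2 : ℝ) ^ (B + 1 + k) else 0) =
          2 * ∑ k ∈ Finset.range B, (if x + unitVec k ∈ interval B 0 then
          (2 : ℝ) ^ (B + k) else 0) := by
        rw [Finset.mul_sum]
        refine Finset.sum_congr rfl fun k hk => ?_
        have hk' := Finset.mem_range.mp hk
        rw [mem_interval_succ_iff]
        simp only [Pi.add_apply, unitVec_of_ne (show B ≠ k by omega), h1, Pi.zero_apply, add_zero,
          and_true]
        split_ifs
        · ring
        · ring
      rw [hs, mem_interval_succ_iff, h2, h1]
      simp only [Pi.zero_apply, and_true, zero_ne_one, and_false, if_false]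
      have e : (2 : ℝ) ^ (B + B) = 2 ^ B * 2 ^ B := by ring
      have e2 : (2 : ℝ) ^ (B + 1 + (B + 1)) = 4 * (2 ^ B * 2 ^ B) := by ring
      have : (0 : ℝ) < 2 ^ B * 2 ^ B := by positivity
      split_ifs at ih ⊢ with h
      · rw [e2]; rw [e] at ih; linarith
      · linarith
    · have hs : 0 ≤ ∑ k ∈ Finset.range B, (if x + unitVec k ∈ interval (B + 1) 0 then
          (2 : ℝ) ^ (B + 1 + k) else 0) := Finset.sum_nonneg fun k _ => by split_ifs <;> positivity
      rw [mem_interval_succ_iff, h2, h1]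
      simp only [and_true, Pi.zero_apply, one_ne_zero, and_false, if_false]
      have e2 : (2 : ℝ) ^ (B + 1 + B) = 2 * (2 ^ B * 2 ^ B) := by ring
      have : (0 : ℝ) < 2 ^ B * 2 ^ B := by positivity
      split_ifs with h
      · rw [e2]; linarith
      · linarith

/-- Each top digit removed costs `K + m D`, two terms bounded by `majorant A`, and leaves a
remainder multiplied by a function of modulus one. -/
theorem abs_fejerSum_le {A n : ℕ} (h : n < 2 ^ A) (x : G) :
    |fejerSum n x| ≤ 2 * ∑ B ∈ Finset.range A, majorant B 0 x := by
  classical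
  induction A generalizing n with
  | zero =>
    obtain rfl : n = 0 := by simpa using h
    simp [fejerSum]
  | succ A ih =>
    rw [Finset.sum_range_succ, mul_add]
    rcases lt_or_ge n (2 ^ A) with h1 | h1
    · have := majorant_nonneg A 0 x
      linarith [ih h1]
    · obtain ⟨m, rfl⟩ := Nat.exists_eq_add_of_le h1
      have hm : m < 2 ^ A := by rw [pow_succ] at h; omega
      rw [fejerSum_two_pow_add hm.le]
      have hD : 0 ≤ dirichlet (2 ^ A) x := by rw [dirichlet_two_pow]; split_ifs <;> positivity
      have h2 : m * dirichlet (2 ^ A) x ≤ majorant A 0 x := by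
        refine le_trans ?_ (two_pow_mul_dirichlet_le_majorant A x)
        exact mul_le_mul_of_nonneg_right (by exact_mod_cast hm.le) hD
      have h3 := fejerSum_two_pow_le_majorant A x
      have h4 := fejerSum_two_pow_nonneg A x
      have h5 := ih hm
      have h6 : 0 ≤ m * dirichlet (2 ^ A) x := by positivity
      calc _ ≤ |fejerSum (2 ^ A) x + m * dirichlet (2 ^ A) x| + |rademacher A x * fejerSum m x| :=
            abs_add_le _ _
        _ ≤ _ := by
          rw [abs_mul, abs_rademacher, one_mul, abs_of_nonneg (by positivity)]
          linarith

/-! ### Subadditivity of the square root and the Fejér operators -/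

theorem sqrt_add_le_add_sqrt {a b : ℝ} (ha : 0 ≤ a) (hb : 0 ≤ b) : √(a + b) ≤ √a + √b := by
  rw [Real.sqrt_le_left (by positivity)]
  nlinarith [Real.sq_sqrt ha, Real.sq_sqrt hb, Real.sqrt_nonneg a, Real.sqrt_nonneg b,
    mul_nonneg (Real.sqrt_nonneg a) (Real.sqrt_nonneg b)]

theorem sqrt_sum_le_sum_sqrt {ι : Type*} (s : Finset ι) (f : ι → ℝ) (hf : ∀ i ∈ s, 0 ≤ f i) :
    √(∑ i ∈ s, f i) ≤ ∑ i ∈ s, √(f i) := by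
  classical
  induction s using Finset.induction_on with
  | empty => simp
  | insert i s hi ih =>
    rw [Finset.sum_insert hi, Finset.sum_insert hi]
    have h1 := sqrt_add_le_add_sqrt (hf i (Finset.mem_insert_self i s))
      (Finset.sum_nonneg fun j hj => hf j (Finset.mem_insert_of_mem hj))
    have h2 := ih fun j hj => hf j (Finset.mem_insert_of_mem hj)
    linarith

/-- Convolution of `g` with the Fejér kernel of order `n`. -/
noncomputable def fejerOp (n : ℕ) (g : G → ℝ) (x : G) : ℝ :=
  1 / (n : ℝ) * ∫ t, g t * fejerSum n (x + t) ∂μ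

theorem integrable_mul_walsh {g : G → ℝ} (hg : Integrable g μ) (k : ℕ) :
    Integrable (fun t => g t * walsh k t) μ :=
  hg.mul_bdd (c := 1) (measurable_walsh k).aestronglyMeasurable
    (Eventually.of_forall fun x => (abs_walsh k x).le)

theorem mul_fejerSum_eq (n : ℕ) (g : G → ℝ) (x t : G) : g t * fejerSum n (x + t) =
    ∑ k ∈ Finset.range n, ∑ i ∈ Finset.range (k + 1), g t * walsh i t * walsh i x := by
  simp only [fejerSum, dirichlet, walsh_add, Finset.mul_sum]
  exact Finset.sum_congr rfl fun _ _ => Finset.sum_congr rfl fun _ _ => by ring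

theorem integrable_mul_fejerSum {g : G → ℝ} (hg : Integrable g μ) (n : ℕ) (x : G) :
    Integrable (fun t => g t * fejerSum n (x + t)) μ := by
  simp only [mul_fejerSum_eq]
  exact integrable_finsetSum _ fun k _ => integrable_finsetSum _ fun i _ =>
    (integrable_mul_walsh hg i).mul_const _

theorem fejerOp_eq_sum {g : G → ℝ} (hg : Integrable g μ) (n : ℕ) (x : G) :
    fejerOp n g x = 1 / (n : ℝ) * ∑ k ∈ Finset.range n, ∑ i ∈ Finset.range (k + 1),
      (∫ t, g t * walsh i t ∂μ) * walsh i x := by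
  simp only [fejerOp, mul_fejerSum_eq]
  rw [integral_finsetSum _ fun k _ => integrable_finsetSum _ fun i _ =>
    (integrable_mul_walsh hg i).mul_const _]
  congr 1
  refine Finset.sum_congr rfl fun k _ => ?_
  rw [integral_finsetSum _ fun i _ => (integrable_mul_walsh hg i).mul_const _]
  exact Finset.sum_congr rfl fun i _ => integral_mul_const _ _

theorem measurable_fejerOp {g : G → ℝ} (hg : Integrable g μ) (n : ℕ) :
    Measurable (fejerOp n g) := by
  have : fejerOp n g = _ := funext fun x => fejerOp_eq_sum hg n x
  rw [this]
  refine Measurable.const_mul ?_ _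
  exact Finset.measurable_fun_sum _ fun k _ => Finset.measurable_fun_sum _ fun i _ =>
    (measurable_walsh i).const_mul _

/-- For `k < 2 ^ N` the function `w_k` is `ζ N`-measurable, so the defining sequence is constant
from `N` on. Hence each Fejér mean of a martingale is a convolution with one `F N`. -/
theorem fourierCoeff_eq_integral {F : ℕ → G → ℝ} (hF : Martingale F ζ μ) {k N : ℕ}
    (h : k < 2 ^ N) : fourierCoeff F k = ∫ x, F N x * walsh k x ∂μ := by
  refine tendsto_nhds_unique (tendsto_fourierCoeff hF k) ?_
  refine tendsto_const_nhds.congr' ((eventually_ge_atTop N).mono fun n hn => ?_)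
  have hw := stronglyMeasurable_walsh h
  have h1 : μ[F n * walsh k | ζ N] =ᵐ[μ] F N * walsh k :=
    (condExp_mul_of_stronglyMeasurable_right hw (integrable_mul_walsh (hF.integrable n) k)
      (hF.integrable n)).trans ((hF.2 N n hn).mul (EventuallyEq.refl _ _))
  have h2 := integral_condExp (μ := μ) (f := F n * walsh k) (ζ.le N)
  rw [integral_congr_ae h1] at h2
  exact h2

theorem sum_Icc_one_eq_sum_range (f : ℕ → ℝ) (n : ℕ) :
    ∑ k ∈ Finset.Icc 1 n, f k = ∑ k ∈ Finset.range n, f (k + 1) := by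
  induction n with
  | zero => simp
  | succ n ih => rw [Finset.sum_Icc_succ_top (by omega), ih, Finset.sum_range_succ]

theorem fejerMean_eq_fejerOp {F : ℕ → G → ℝ} (hF : Martingale F ζ μ) {n N : ℕ} (h : n ≤ 2 ^ N)
    (x : G) : fejerMean n F x = fejerOp n (F N) x := by
  rw [fejerOp_eq_sum (hF.integrable N), fejerMean, sum_Icc_one_eq_sum_range]
  congr 1
  refine Finset.sum_congr rfl fun k hk => Finset.sum_congr rfl fun i hi => ?_
  rw [fourierCoeff_eq_integral hF (N := N)]
  rw [Finset.mem_range] at hk hi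
  omega

theorem measurable_fejerMean (n : ℕ) (F : ℕ → G → ℝ) : Measurable (fejerMean n F) := by
  unfold fejerMean partialSum
  refine Measurable.const_mul ?_ _
  exact Finset.measurable_fun_sum _ fun k _ => Finset.measurable_fun_sum _ fun i _ =>
    (measurable_walsh i).const_mul _

theorem fejerOp_add {g h : G → ℝ} (hg : Integrable g μ) (hh : Integrable h μ) (n : ℕ) (x : G) :
    fejerOp n (fun t => g t + h t) x = fejerOp n g x + fejerOp n h x := by
  simp only [fejerOp, add_mul]
  rw [integral_add (integrable_mul_fejerSum hg n x) (integrable_mul_fejerSum hh n x), mul_add]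

/-- The square root of the maximal operator `sup_n |σ_n g| / log²(n+1)`. -/
noncomputable def sqrtMaximal (g : G → ℝ) (x : G) : ℝ≥0∞ :=
  ⨆ n ≥ 1, ENNReal.ofReal (√|fejerOp n g x| / Real.log ((n : ℝ) + 1))

theorem measurable_sqrtMaximal {g : G → ℝ} (hg : Integrable g μ) : Measurable (sqrtMaximal g) := by
  refine Measurable.iSup fun n => Measurable.iSup fun _ => ?_
  have := measurable_fejerOp hg n
  fun_prop

theorem log_natCast_add_one_nonneg (n : ℕ) : 0 ≤ Real.log ((n : ℝ) + 1) :=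
  Real.log_nonneg (by linarith [n.cast_nonneg (α := ℝ)])

theorem sqrtMaximal_add_le {g h : G → ℝ} (hg : Integrable g μ) (hh : Integrable h μ) (x : G) :
    sqrtMaximal (fun t => g t + h t) x ≤ sqrtMaximal g x + sqrtMaximal h x := by
  refine iSup₂_le fun n hn => ?_
  have hl := log_natCast_add_one_nonneg n
  calc ENNReal.ofReal (√|fejerOp n (fun t => g t + h t) x| / Real.log ((n : ℝ) + 1))
      ≤ ENNReal.ofReal (√|fejerOp n g x| / Real.log ((n : ℝ) + 1) +
          √|fejerOp n h x| / Real.log ((n : ℝ) + 1)) := by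
        rw [fejerOp_add hg hh, ← add_div]
        refine ENNReal.ofReal_le_ofReal (div_le_div_of_nonneg_right ?_ hl)
        exact (Real.sqrt_le_sqrt (abs_add_le _ _)).trans
          (sqrt_add_le_add_sqrt (abs_nonneg _) (abs_nonneg _))
    _ = _ := ENNReal.ofReal_add (by positivity) (by positivity)
    _ ≤ _ := add_le_add
        (le_iSup₂ (f := fun n (_ : n ≥ 1) =>
          ENNReal.ofReal (√|fejerOp n g x| / Real.log ((n : ℝ) + 1))) n hn)
        (le_iSup₂ (f := fun n (_ : n ≥ 1) =>
          ENNReal.ofReal (√|fejerOp n h x| / Real.log ((n : ℝ) + 1))) n hn)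

theorem sqrtMaximal_zero (x : G) : sqrtMaximal (fun _ => 0) x = 0 := by
  simp [sqrtMaximal, fejerOp]

theorem lintegral_sqrtMaximal_add_le {g h : G → ℝ} (hg : Integrable g μ) (hh : Integrable h μ) :
    ∫⁻ x, sqrtMaximal (fun t => g t + h t) x ∂μ ≤
      ∫⁻ x, sqrtMaximal g x ∂μ + ∫⁻ x, sqrtMaximal h x ∂μ := by
  rw [← lintegral_add_left (measurable_sqrtMaximal hg)]
  exact lintegral_mono fun x => sqrtMaximal_add_le hg hh x

theorem lintegral_sqrtMaximal_sum_le {ι : Type*} (s : Finset ι) (g : ι → G → ℝ)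
    (hg : ∀ i ∈ s, Integrable (g i) μ) :
    ∫⁻ x, sqrtMaximal (fun t => ∑ i ∈ s, g i t) x ∂μ ≤ ∑ i ∈ s, ∫⁻ x, sqrtMaximal (g i) x ∂μ := by
  classical
  induction s using Finset.induction_on with
  | empty => simp [sqrtMaximal_zero]
  | insert i s hi ih =>
    simp only [Finset.sum_insert hi]
    refine (lintegral_sqrtMaximal_add_le (hg i (Finset.mem_insert_self i s))
      (integrable_finsetSum _ fun j hj => hg j (Finset.mem_insert_of_mem hj))).trans ?_
    gcongr
    exact ih fun j hj => hg j (Finset.mem_insert_of_mem hj)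

/-! ### The estimate for atoms -/

theorem abs_fejerOp_le_sum {g : G → ℝ} {c : ℝ} {M : ℕ} {z : G} (hc : ∀ x, |g x| ≤ c)
    (hsupp : ∀ x ∉ interval M z, g x = 0) {n A : ℕ} (hn : n < 2 ^ A) (x : G) :
    |fejerOp n g x| ≤ 2 * c / n * ∑ B ∈ Finset.range A, ∑ k ∈ Finset.range (B + 1),
      (2 : ℝ) ^ (B + k) * μ.real (interval M z ∩ interval B (x + unitVec k)) := by
  classical
  have hc0 : 0 ≤ c := (abs_nonneg _).trans (hc 0)
  have hms : ∀ B k, MeasurableSet (interval M z ∩ interval B (x + unitVec k)) := fun B k =>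
    (measurableSet_interval _ _).inter (measurableSet_interval _ _)
  have hint : ∀ B k, Integrable (fun t => (2 : ℝ) ^ (B + k) *
      (interval M z ∩ interval B (x + unitVec k)).indicator (fun _ => (1 : ℝ)) t) μ := fun B k =>
    ((integrable_const 1).indicator (hms B k)).const_mul _
  have hpt : ∀ t, ‖g t * fejerSum n (x + t)‖ ≤ 2 * c * ∑ B ∈ Finset.range A,
      ∑ k ∈ Finset.range (B + 1), (2 : ℝ) ^ (B + k) *
        (interval M z ∩ interval B (x + unitVec k)).indicator (fun _ => (1 : ℝ)) t := by
    intro t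
    by_cases ht : t ∈ interval M z
    · have h1 := abs_fejerSum_le hn (x + t)
      rw [Real.norm_eq_abs, abs_mul]
      calc |g t| * |fejerSum n (x + t)| ≤ c * (2 * ∑ B ∈ Finset.range A, majorant B 0 (x + t)) :=
            mul_le_mul (hc t) h1 (abs_nonneg _) hc0
        _ = _ := by
          rw [← mul_assoc, mul_comm c 2]
          congr 1
          refine Finset.sum_congr rfl fun B _ => Finset.sum_congr rfl fun k _ => ?_
          have : x + t + unitVec k ∈ interval B 0 ↔ t ∈ interval B (x + unitVec k) := by
            rw [show x + t + unitVec k = t + (x + unitVec k) by abel, add_mem_interval_iff,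
              zero_add]
          simp [Set.indicator_apply, this, ht]
    · rw [hsupp t ht, zero_mul, norm_zero]
      have : ∀ B k, 0 ≤ (2 : ℝ) ^ (B + k) *
        (interval M z ∩ interval B (x + unitVec k)).indicator (fun _ => (1 : ℝ)) t := fun B k =>
        mul_nonneg (by positivity) (Set.indicator_nonneg (fun _ _ => zero_le_one) _)
      exact mul_nonneg (by positivity) (Finset.sum_nonneg fun B _ => Finset.sum_nonneg
        fun k _ => this B k)
  have hI := norm_integral_le_of_norm_le (μ := μ) ((integrable_finsetSum _ fun B _ =>
    integrable_finsetSum _ fun k _ => hint B k).const_mul (2 * c)) (Eventually.of_forall hpt)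
  rw [integral_const_mul, integral_finsetSum _ fun B _ =>
    integrable_finsetSum _ fun k _ => hint B k] at hI
  simp only [integral_finsetSum _ fun k _ => hint _ k, integral_const_mul,
    integral_indicator_const _ (hms _ _), smul_eq_mul, mul_one] at hI
  rw [fejerOp, abs_mul, abs_of_nonneg (by positivity : (0 : ℝ) ≤ 1 / n)]
  calc _ ≤ 1 / (n : ℝ) * _ := mul_le_mul_of_nonneg_left hI (by positivity)
    _ = _ := by ring

theorem sum_range_two_pow_le (n : ℕ) : ∑ k ∈ Finset.range n, (2 : ℝ) ^ k ≤ 2 ^ n := by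
  rw [geom_sum_eq (by norm_num)]
  have : (0 : ℝ) < 2 ^ n := by positivity
  linarith

theorem abs_fejerOp_le {g : G → ℝ} {c : ℝ} (hc : ∀ x, |g x| ≤ c) {n : ℕ} (hn : 1 ≤ n) (x : G) :
    |fejerOp n g x| ≤ 8 * c := by
  have hc0 : 0 ≤ c := (abs_nonneg _).trans (hc 0)
  have h := abs_fejerOp_le_sum (M := 0) (z := 0) hc (fun x hx => (hx (by simp [interval])).elim)
    (Nat.lt_pow_succ_log_self one_lt_two n) x
  have hA := Nat.pow_log_le_self 2 (show n ≠ 0 by omega)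
  set A := Nat.log 2 n
  have h2 : ∑ B ∈ Finset.range (A + 1), ∑ k ∈ Finset.range (B + 1),
      (2 : ℝ) ^ (B + k) * μ.real (interval 0 0 ∩ interval B (x + unitVec k)) ≤ 4 * 2 ^ A := by
    calc _ ≤ ∑ B ∈ Finset.range (A + 1), 2 * (2 : ℝ) ^ B := by
          refine Finset.sum_le_sum fun B _ => ?_
          rw [← pow_succ']
          refine le_trans (Finset.sum_le_sum fun k _ => ?_) (sum_range_two_pow_le _)
          calc (2 : ℝ) ^ (B + k) * μ.real (interval 0 0 ∩ interval B (x + unitVec k))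
              ≤ 2 ^ (B + k) * μ.real (interval B (x + unitVec k)) :=
                mul_le_mul_of_nonneg_left (measureReal_mono Set.inter_subset_right) (by positivity)
            _ = 2 ^ k := by rw [real_interval, pow_add]; field_simp
      _ = 2 * ∑ B ∈ Finset.range (A + 1), (2 : ℝ) ^ B := by rw [Finset.mul_sum]
      _ ≤ _ := by have := sum_range_two_pow_le (A + 1); rw [pow_succ] at this; linarith
  have hn0 : (0 : ℝ) < n := by exact_mod_cast hn
  have hA' : (2 : ℝ) ^ A ≤ n := by exact_mod_cast hA
  calc _ ≤ _ := h
    _ ≤ 2 * c / n * (4 * n) := mul_le_mul_of_nonneg_left (by linarith) (by positivity)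
    _ = 8 * c := by field_simp; ring

/-- Only Walsh functions of index below `2 ^ M` occur, so the kernel is constant on the support and
the mean-zero condition applies. -/
theorem fejerOp_eq_zero {g : G → ℝ} {M : ℕ} {z : G} (hsupp : ∀ x ∉ interval M z, g x = 0)
    (hmean : ∫ x, g x ∂μ = 0) {n : ℕ} (hn : n ≤ 2 ^ M) (x : G) : fejerOp n g x = 0 := by
  have : ∀ t, g t * fejerSum n (x + t) = g t * fejerSum n (x + z) := by
    intro t
    by_cases ht : t ∈ interval M z
    · congr 1
      refine Finset.sum_congr rfl fun k hk => Finset.sum_congr rfl fun i hi => ?_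
      rw [Finset.mem_range] at hk hi
      refine walsh_eq_of_mem_interval (n := M) (by omega) ?_
      rw [add_comm x t, add_comm x z]
      exact add_mem_interval ht x
    · simp [hsupp t ht]
  simp [fejerOp, this, integral_mul_const, hmean]

/-- For scales `B ≤ M` the intersection with the support is all of `I_M(z)` or empty. For `B > M`,
changing a digit of index above `M` cannot move `x` into `I_M(z)`, so only `k ≤ M` survives and each
scale contributes at most the scale `M` term. There are `D = log₂ n - M` such scales, and `1 + D ≤
2^D ≤ n / 2^M` is absorbed by the factor `1 / n`. -/
theorem abs_fejerOp_le_majorant {g : G → ℝ} {c : ℝ} {M : ℕ} {z : G} (hc : ∀ x, |g x| ≤ c)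
    (hsupp : ∀ x ∉ interval M z, g x = 0) {n : ℕ} (hn : 2 ^ M ≤ n) {x : G}
    (hx : x ∉ interval M z) :
    |fejerOp n g x| ≤ 2 * c * ((2 ^ M)⁻¹) ^ 2 * ∑ B ∈ Finset.range (M + 1), majorant B z x := by
  classical
  have hc0 : 0 ≤ c := (abs_nonneg _).trans (hc 0)
  have hn1 : 1 ≤ n := Nat.one_le_two_pow.trans hn
  have hM : M ≤ Nat.log 2 n := Nat.le_log_of_pow_le one_lt_two hn
  obtain ⟨D, hD⟩ := Nat.exists_eq_add_of_le hM
  have h := abs_fejerOp_le_sum hc hsupp (Nat.lt_pow_succ_log_self one_lt_two n) x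
  have hA := Nat.pow_log_le_self 2 (show n ≠ 0 by omega)
  rw [hD] at h hA
  rw [show (M + D).succ = M + 1 + D by omega, Finset.sum_range_add] at h
  set W := ∑ B ∈ Finset.range (M + 1), majorant B z x with hW
  have hWM : majorant M z x ≤ W :=
    Finset.single_le_sum (fun B _ => majorant_nonneg B z x) (Finset.self_mem_range_succ M)
  have hW0 : 0 ≤ W := (majorant_nonneg M z x).trans hWM
  have hsmall : ∑ B ∈ Finset.range (M + 1), ∑ k ∈ Finset.range (B + 1),
      (2 : ℝ) ^ (B + k) * μ.real (interval M z ∩ interval B (x + unitVec k)) ≤ (2 ^ M)⁻¹ * W := by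
    rw [hW, Finset.mul_sum]
    refine Finset.sum_le_sum fun B hB => ?_
    rw [majorant, Finset.mul_sum]
    refine Finset.sum_le_sum fun k _ => ?_
    have hB' : B ≤ M := by have := Finset.mem_range.mp hB; omega
    split_ifs with hk
    · rw [mul_comm, ← real_interval M z]
      exact mul_le_mul_of_nonneg_right (measureReal_mono Set.inter_subset_left) (by positivity)
    · have : interval M z ∩ interval B (x + unitVec k) = ∅ := by
        ext t
        simp only [Set.mem_inter_iff, Set.mem_empty_iff_false, iff_false, not_and]
        intro h1 h2
        refine hk ?_
        rw [← interval_eq_of_mem (interval_anti hB' z h1)]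
        exact mem_interval_comm.mp h2
      simp [this]
  have hlarge : ∀ B ∈ Finset.range D, ∑ k ∈ Finset.range (M + 1 + B + 1),
      (2 : ℝ) ^ (M + 1 + B + k) * μ.real (interval M z ∩ interval (M + 1 + B) (x + unitVec k)) ≤
        (2 ^ M)⁻¹ * W := by
    intro B _
    have hle : (2 ^ M)⁻¹ * majorant M z x ≤ (2 ^ M)⁻¹ * W :=
      mul_le_mul_of_nonneg_left hWM (by positivity)
    refine le_trans ?_ hle
    have hempty : ∀ k, x + unitVec k ∉ interval M z →
        interval M z ∩ interval (M + 1 + B) (x + unitVec k) = ∅ := by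
      intro k hk
      ext t
      simp only [Set.mem_inter_iff, Set.mem_empty_iff_false, iff_false, not_and]
      intro h1 h2
      refine hk ?_
      rw [← interval_eq_of_mem h1]
      exact mem_interval_comm.mp (interval_anti (by omega) _ h2)
    rw [show M + 1 + B + 1 = M + 1 + (B + 1) by omega, Finset.sum_range_add]
    rw [Finset.sum_eq_zero (s := Finset.range (B + 1)), add_zero, majorant, Finset.mul_sum]
    · refine Finset.sum_le_sum fun k _ => ?_
      split_ifs with hk
      · calc _ ≤ (2 : ℝ) ^ (M + 1 + B + k) * μ.real (interval (M + 1 + B) (x + unitVec k)) :=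
              mul_le_mul_of_nonneg_left (measureReal_mono Set.inter_subset_right) (by positivity)
          _ = (2 ^ M)⁻¹ * 2 ^ (M + k) := by
              rw [real_interval, pow_add _ (M + 1 + B), pow_add _ M k]; field_simp
      · simp [hempty k hk]
    · intro k _
      rw [hempty, measureReal_empty, mul_zero]
      rw [mem_interval_comm,
        interval_eq_of_mem (add_unitVec_mem_interval (by omega) x), mem_interval_comm]
      exact hx
  have hD2 : (1 + D : ℝ) ≤ 2 ^ D := by
    have := Nat.lt_two_pow_self (n := D)
    have h2 : 1 + D ≤ 2 ^ D := by omega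
    exact_mod_cast h2
  have hn0 : (0 : ℝ) < n := by exact_mod_cast hn1
  have hA' : (2 : ℝ) ^ M * 2 ^ D ≤ n := by rw [← pow_add]; exact_mod_cast hA
  have htot := add_le_add hsmall (Finset.sum_le_sum hlarge)
  rw [Finset.sum_const, Finset.card_range, nsmul_eq_mul] at htot
  have hp : (0 : ℝ) < 2 ^ M := by positivity
  calc _ ≤ _ := h
    _ ≤ 2 * c / n * ((2 ^ M)⁻¹ * W + D * ((2 ^ M)⁻¹ * W)) :=
        mul_le_mul_of_nonneg_left htot (by positivity)
    _ = 2 * c * (2 ^ M)⁻¹ * W * ((1 + D) / n) := by ring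
    _ ≤ 2 * c * (2 ^ M)⁻¹ * W * (2 ^ M)⁻¹ := by
        refine mul_le_mul_of_nonneg_left ?_ (by positivity)
        rw [div_le_iff₀ hn0, inv_mul_eq_div, le_div_iff₀ hp]
        nlinarith
    _ = _ := by ring

/-- The square-root majorant, which dominates `√(∑_{B ≤ M} majorant B z x)`. -/
noncomputable def sqrtMajorant (M : ℕ) (z x : G) : ℝ :=
  ∑ B ∈ Finset.range (M + 1), ∑ k ∈ Finset.range (B + 1),
    √2 ^ (B + k) * (interval B (z + unitVec k)).indicator (fun _ => (1 : ℝ)) x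

theorem sqrt_sum_majorant_le (M : ℕ) (z x : G) :
    √(∑ B ∈ Finset.range (M + 1), majorant B z x) ≤ sqrtMajorant M z x := by
  classical
  refine (sqrt_sum_le_sum_sqrt _ _ fun B _ => majorant_nonneg B z x).trans ?_
  refine Finset.sum_le_sum fun B _ => ?_
  refine (sqrt_sum_le_sum_sqrt _ _ fun k _ => by split_ifs <;> positivity).trans ?_
  refine Finset.sum_le_sum fun k _ => ?_
  rw [add_mem_interval_iff, Set.indicator_apply]
  split_ifs
  · rw [mul_one, Real.sqrt_le_left (by positivity), ← pow_mul, mul_comm, pow_mul,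
      Real.sq_sqrt zero_le_two]
  · simp

theorem sqrtMajorant_nonneg (M : ℕ) (z x : G) : 0 ≤ sqrtMajorant M z x :=
  (Real.sqrt_nonneg _).trans (sqrt_sum_majorant_le M z x)

theorem sqrt_two_bounds : 1.4 ≤ √2 ∧ √2 ≤ 1.5 := by
  constructor
  · exact Real.le_sqrt_of_sq_le (by norm_num)
  · exact Real.sqrt_le_iff.mpr (by norm_num)

theorem sum_range_sqrt_two_pow_le (B : ℕ) :
    ∑ k ∈ Finset.range (B + 1), √2 ^ k ≤ 4 * √2 ^ B := by
  induction B with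
  | zero => simp
  | succ B ih =>
    rw [Finset.sum_range_succ, pow_succ]
    have h : 0 < √2 ^ B := by positivity
    nlinarith [sqrt_two_bounds.1]

theorem integrable_sqrtMajorant (M : ℕ) (z : G) : Integrable (sqrtMajorant M z) μ :=
  integrable_finsetSum _ fun _ _ => integrable_finsetSum _ fun _ _ =>
    ((integrable_const 1).indicator (measurableSet_interval _ _)).const_mul _

/-- Scale `B` contributes `∑_{k ≤ B} √2^(k-B) ≤ 4`. The linear growth in `M` is what the logarithmic
weight has to compensate. -/
theorem integral_sqrtMajorant_le (M : ℕ) (z : G) :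
    ∫ x, sqrtMajorant M z x ∂μ ≤ 4 * (M + 1) := by
  have hint : ∀ B k, Integrable (fun x => √2 ^ (B + k) *
      (interval B (z + unitVec k)).indicator (fun _ => (1 : ℝ)) x) μ := fun B k =>
    ((integrable_const 1).indicator (measurableSet_interval _ _)).const_mul _
  unfold sqrtMajorant
  rw [integral_finsetSum _ fun B _ => integrable_finsetSum _ fun k _ => hint B k]
  simp only [integral_finsetSum _ fun k _ => hint _ k, integral_const_mul,
    integral_indicator_const _ (measurableSet_interval _ _), smul_eq_mul, mul_one, real_interval]
  calc _ ≤ ∑ B ∈ Finset.range (M + 1), (4 : ℝ) := by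
        refine Finset.sum_le_sum fun B _ => ?_
        rw [← Finset.sum_mul]
        simp only [pow_add]
        rw [← Finset.mul_sum, ← div_eq_mul_inv, div_le_iff₀ (by positivity)]
        have h := sum_range_sqrt_two_pow_le B
        have h2 : √2 ^ B * √2 ^ B = 2 ^ B := by rw [← mul_pow, Real.mul_self_sqrt zero_le_two]
        have h3 : 0 < √2 ^ B := by positivity
        nlinarith
    _ = 4 * (M + 1) := by simp [mul_comm]

theorem lintegral_sqrtMaximal_atom_le {g : G → ℝ} {c : ℝ} {M : ℕ} {z : G}
    (hc : ∀ x, |g x| ≤ c) (hsupp : ∀ x ∉ interval M z, g x = 0)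
    (hmean : M = 0 ∨ ∫ x, g x ∂μ = 0) :
    ∫⁻ x, sqrtMaximal g x ∂μ ≤ ENNReal.ofReal (30 * √c * (2 ^ M)⁻¹) := by
  classical
  have hc0 : 0 ≤ c := (abs_nonneg _).trans (hc 0)
  have hl2 : (0.5 : ℝ) ≤ Real.log 2 := by have := Real.log_two_gt_d9; norm_num at this ⊢; linarith
  -- The first term serves the interval itself (`3 ≥ √8`), the second its complement (`1.5 ≥ √2`);
  -- `0.5` is a lower bound for `log 2`. For `M = 0` the second coefficient is zero by division by
  -- zero, which is harmless because the complement is empty.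
  set f : G → ℝ := fun x => 3 * √c / 0.5 * (interval M z).indicator (fun _ => (1 : ℝ)) x +
    1.5 * √c * (2 ^ M)⁻¹ / (M * 0.5) * sqrtMajorant M z x with hf
  have hf0 : ∀ x, 0 ≤ f x := fun x => add_nonneg
    (mul_nonneg (by positivity) (Set.indicator_nonneg (fun _ _ => zero_le_one) _))
    (mul_nonneg (by positivity) (sqrtMajorant_nonneg _ _ _))
  have hpt : ∀ x, sqrtMaximal g x ≤ ENNReal.ofReal (f x) := by
    intro x
    refine iSup₂_le fun n hn => ENNReal.ofReal_le_ofReal ?_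
    have hn1 : (1 : ℝ) ≤ n := by exact_mod_cast hn
    by_cases hx : x ∈ interval M z
    · have h1 : √|fejerOp n g x| ≤ 3 * √c := by
        calc √|fejerOp n g x| ≤ √(3 ^ 2 * c) :=
              Real.sqrt_le_sqrt ((abs_fejerOp_le hc hn x).trans (by linarith))
          _ = 3 * √c := by rw [Real.sqrt_mul (by norm_num), Real.sqrt_sq (by norm_num)]
      have h2 : 0.5 ≤ Real.log ((n : ℝ) + 1) :=
        hl2.trans (Real.log_le_log (by norm_num) (by linarith))
      calc _ ≤ 3 * √c / 0.5 := div_le_div₀ (by positivity) h1 (by norm_num) h2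
        _ ≤ f x := by
          simp only [hf, Set.indicator_of_mem hx, mul_one]
          exact le_add_of_nonneg_right (mul_nonneg (by positivity) (sqrtMajorant_nonneg _ _ _))
    · have hM : M ≠ 0 := by
        rintro rfl
        exact hx (by simp [interval])
      rcases le_or_gt n (2 ^ M) with hnM | hnM
      · rw [fejerOp_eq_zero hsupp (hmean.resolve_left hM) hnM]
        simpa using hf0 x
      · have hM1 : (1 : ℝ) ≤ M := by exact_mod_cast Nat.one_le_iff_ne_zero.mpr hM
        have h1 : √|fejerOp n g x| ≤ 1.5 * √c * (2 ^ M)⁻¹ * sqrtMajorant M z x := by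
          calc √|fejerOp n g x| ≤ √(2 * c * ((2 ^ M)⁻¹) ^ 2 *
                ∑ B ∈ Finset.range (M + 1), majorant B z x) :=
                Real.sqrt_le_sqrt (abs_fejerOp_le_majorant hc hsupp hnM.le hx)
            _ = √2 * √c * (2 ^ M)⁻¹ * √(∑ B ∈ Finset.range (M + 1), majorant B z x) := by
                rw [Real.sqrt_mul (by positivity), Real.sqrt_mul (by positivity),
                  Real.sqrt_mul (by positivity), Real.sqrt_sq (by positivity)]
            _ ≤ _ := by
                gcongr
                · exact sqrt_two_bounds.2
                · exact sqrt_sum_majorant_le M z x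
        -- Only `n > 2^M` remains here, so the weight supplies the factor `M` that cancels the
        -- integral of `sqrtMajorant`.
        have h2 : M * 0.5 ≤ Real.log ((n : ℝ) + 1) := by
          calc M * 0.5 ≤ M * Real.log 2 := by gcongr
            _ = Real.log (2 ^ M) := by rw [Real.log_pow]
            _ ≤ _ := Real.log_le_log (by positivity) (by
                have : (2 : ℝ) ^ M ≤ n := by exact_mod_cast hnM.le
                linarith)
        have h3 := sqrtMajorant_nonneg M z x
        calc _ ≤ 1.5 * √c * (2 ^ M)⁻¹ * sqrtMajorant M z x / (M * 0.5) :=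
              div_le_div₀ (by positivity) h1 (by positivity) h2
          _ = f x := by
            simp only [hf, Set.indicator_of_notMem hx, mul_zero, zero_add]
            ring
  have hi1 : Integrable (fun x => 3 * √c / 0.5 *
      (interval M z).indicator (fun _ => (1 : ℝ)) x) μ :=
    ((integrable_const 1).indicator (measurableSet_interval _ _)).const_mul _
  have hi2 := (integrable_sqrtMajorant M z).const_mul (1.5 * √c * (2 ^ M)⁻¹ / (M * 0.5))
  calc _ ≤ ∫⁻ x, ENNReal.ofReal (f x) ∂μ := lintegral_mono hpt
    _ = ENNReal.ofReal (∫ x, f x ∂μ) :=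
        (ofReal_integral_eq_lintegral_ofReal (hi1.add hi2) (Eventually.of_forall hf0)).symm
    _ ≤ _ := by
      refine ENNReal.ofReal_le_ofReal ?_
      rw [integral_add hi1 hi2, integral_const_mul, integral_const_mul,
        integral_indicator_const _ (measurableSet_interval _ _), smul_eq_mul, mul_one,
        real_interval]
      have h := integral_sqrtMajorant_le M z
      have hsc := Real.sqrt_nonneg c
      rcases Nat.eq_zero_or_pos M with rfl | hM
      · simp only [CharP.cast_eq_zero, zero_mul, div_zero, zero_mul, add_zero, pow_zero, inv_one]
        have : 3 * √c / 0.5 * 1 = 6 * √c := by ring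
        linarith
      · have hM1 : (1 : ℝ) ≤ M := by exact_mod_cast hM
        have h4 : ∫ x, sqrtMajorant M z x ∂μ ≤ 8 * M := h.trans (by linarith)
        calc _ ≤ 3 * √c / 0.5 * (2 ^ M)⁻¹ + 1.5 * √c * (2 ^ M)⁻¹ / (M * 0.5) * (8 * M) := by
              gcongr
          _ = 30 * √c * (2 ^ M)⁻¹ := by field_simp; ring

/-! ### Stopping times and the atomic decomposition -/

theorem martingale_eq_of_mem_interval {F : ℕ → G → ℝ} (hF : Martingale F ζ μ) {n : ℕ} {x y : G}
    (h : y ∈ interval n x) : F n y = F n x :=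
  eq_of_mem_interval_of_stronglyMeasurable (hF.1 n) h

theorem interval_eq_union_add (n : ℕ) (x : G) :
    interval n x = interval (n + 1) x ∪ interval (n + 1) (x + unitVec n) := by
  ext y
  refine ⟨fun h => mem_interval_succ_or h, fun h => h.elim (fun h => interval_anti n.le_succ x h)
    fun h => ?_⟩
  rw [← interval_eq_of_mem (add_unitVec_mem_interval le_rfl x)]
  exact interval_anti n.le_succ _ h

theorem martingale_add_flip {F : ℕ → G → ℝ} (hF : Martingale F ζ μ) (n : ℕ) (x : G) :
    F (n + 1) x + F (n + 1) (x + unitVec n) = 2 * F n x := by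
  have hconst : ∀ m z, ∫ y in interval m z, F m y ∂μ = (2 ^ m)⁻¹ * F m z := by
    intro m z
    rw [setIntegral_congr_fun (g := fun _ => F m z) (measurableSet_interval m z)
      fun y hy => martingale_eq_of_mem_interval hF hy, setIntegral_const, real_interval, smul_eq_mul]
  have h := hF.setIntegral_eq n.le_succ (s := interval n x)
    (MeasurableSpace.measurableSet_generateFrom ⟨x, rfl⟩)
  rw [hconst] at h
  rw [interval_eq_union_add, setIntegral_union (disjoint_interval_succ n x)
    (measurableSet_interval _ _) (hF.integrable _).integrableOn (hF.integrable _).integrableOn,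
    hconst, hconst, pow_succ] at h
  have hp : (0 : ℝ) < 2 ^ n := by positivity
  field_simp at h
  linarith

/-- The larger modulus of `F_{j+1}` on the two halves of `I_j(x)`. -/
noncomputable def childMax (F : ℕ → G → ℝ) (j : ℕ) (x : G) : ℝ :=
  max |F (j + 1) x| |F (j + 1) (x + unitVec j)|

/-- The predictable running maximum of a dyadic martingale. -/
noncomputable def runMax (F : ℕ → G → ℝ) : ℕ → G → ℝ
  | 0, x => childMax F 0 x
  | j + 1, x => max (runMax F j x) (childMax F (j + 1) x)

theorem childMax_le_runMax (F : ℕ → G → ℝ) (j : ℕ) (x : G) : childMax F j x ≤ runMax F j x := by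
  cases j with
  | zero => exact le_rfl
  | succ j => exact le_max_right _ _

theorem runMax_mono (F : ℕ → G → ℝ) (x : G) : Monotone fun j => runMax F j x :=
  monotone_nat_of_le_succ fun _ => le_max_left _ _

theorem childMax_eq_of_mem_interval {F : ℕ → G → ℝ} (hF : Martingale F ζ μ) {j : ℕ} {x y : G}
    (h : y ∈ interval j x) : childMax F j y = childMax F j x := by
  rcases mem_interval_succ_or h with h | h
  · rw [childMax, childMax, martingale_eq_of_mem_interval hF h,
      martingale_eq_of_mem_interval hF (add_mem_interval h _)]
  · have h2 := add_mem_interval h (unitVec j)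
    rw [add_assoc, add_self_G, add_zero] at h2
    rw [childMax, childMax, martingale_eq_of_mem_interval hF h,
      martingale_eq_of_mem_interval hF h2, max_comm]

theorem runMax_eq_of_mem_interval {F : ℕ → G → ℝ} (hF : Martingale F ζ μ) {j : ℕ} {x y : G}
    (h : y ∈ interval j x) : runMax F j y = runMax F j x := by
  induction j with
  | zero => exact childMax_eq_of_mem_interval hF h
  | succ j ih =>
    rw [runMax, runMax, ih (interval_anti j.le_succ x h), childMax_eq_of_mem_interval hF h]

theorem abs_succ_le_runMax (F : ℕ → G → ℝ) (j : ℕ) (x : G) : |F (j + 1) x| ≤ runMax F j x :=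
  (le_max_left _ _).trans (childMax_le_runMax F j x)

theorem abs_le_runMax {F : ℕ → G → ℝ} (hF : Martingale F ζ μ) (j : ℕ) (x : G) :
    |F j x| ≤ runMax F j x := by
  have h := martingale_add_flip hF j x
  have h1 := (le_max_left _ _).trans (childMax_le_runMax F j x)
  have h2 := (le_max_right _ _).trans (childMax_le_runMax F j x)
  have h3 := abs_add_le (F (j + 1) x) (F (j + 1) (x + unitVec j))
  rw [h, abs_mul, abs_two] at h3
  linarith

open Classical in
/-- The increment at time `j` of the martingale stopped as soon as the running maximum
exceeds `L`. -/
noncomputable def stoppedIncr (F : ℕ → G → ℝ) (L : ℝ) (j : ℕ) (x : G) : ℝ :=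
  if runMax F j x ≤ L then F (j + 1) x - F j x else 0

/-- The martingale `F - F_0`, stopped as soon as its running maximum exceeds `L`. -/
noncomputable def stopped (F : ℕ → G → ℝ) (L : ℝ) (N : ℕ) (x : G) : ℝ :=
  ∑ j ∈ Finset.range N, stoppedIncr F L j x

theorem stopped_eq_sub {F : ℕ → G → ℝ} {L : ℝ} {N : ℕ} {x : G}
    (h : ∀ j < N, runMax F j x ≤ L) : stopped F L N x = F N x - F 0 x := by
  rw [← Finset.sum_range_sub (fun j => F j x)]
  exact Finset.sum_congr rfl fun j hj => if_pos (h j (Finset.mem_range.mp hj))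

/-- `runMax F N` already sees both possible values of `F (N + 1)`, so the stopped martingale never
overshoots `L`; the other `L` comes from subtracting `F 0`. -/
theorem abs_stopped_le {F : ℕ → G → ℝ} (hF : Martingale F ζ μ) {L : ℝ} (hL : 0 ≤ L) (N : ℕ)
    (x : G) : |stopped F L N x| ≤ 2 * L := by
  induction N with
  | zero => simpa [stopped] using hL
  | succ N ih =>
    by_cases h : runMax F N x ≤ L
    · have h1 : ∀ j < N + 1, runMax F j x ≤ L := fun j hj =>
        (runMax_mono F x (Nat.lt_succ_iff.mp hj)).trans h
      rw [stopped_eq_sub h1]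
      have h2 := (abs_succ_le_runMax F N x).trans h
      have h3 := (abs_le_runMax hF 0 x).trans (h1 0 N.succ_pos)
      have h4 := abs_sub (F (N + 1) x) (F 0 x)
      linarith
    · rw [stopped, Finset.sum_range_succ, stoppedIncr, if_neg h, add_zero]
      exact ih

theorem stoppedIncr_eq_of_mem_interval {F : ℕ → G → ℝ} (hF : Martingale F ζ μ) (L : ℝ) {j : ℕ}
    {x y : G} (h : y ∈ interval (j + 1) x) : stoppedIncr F L j y = stoppedIncr F L j x := by
  have h' := interval_anti j.le_succ x h
  rw [stoppedIncr, stoppedIncr, runMax_eq_of_mem_interval hF h',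
    martingale_eq_of_mem_interval hF h, martingale_eq_of_mem_interval hF h']

theorem stoppedIncr_flip {F : ℕ → G → ℝ} (hF : Martingale F ζ μ) (L : ℝ) (j : ℕ) (x : G) :
    stoppedIncr F L j (x + unitVec j) = -stoppedIncr F L j x := by
  have h := add_unitVec_mem_interval le_rfl x (n := j)
  rw [stoppedIncr, stoppedIncr, runMax_eq_of_mem_interval hF h,
    martingale_eq_of_mem_interval hF h]
  have := martingale_add_flip hF j x
  split_ifs
  · linarith
  · simp

theorem stopped_eq_of_mem_interval {F : ℕ → G → ℝ} (hF : Martingale F ζ μ) (L : ℝ) {N : ℕ}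
    {x y : G} (h : y ∈ interval N x) : stopped F L N y = stopped F L N x :=
  Finset.sum_congr rfl fun _ hj => stoppedIncr_eq_of_mem_interval hF L
    (interval_anti (Nat.succ_le_of_lt (Finset.mem_range.mp hj)) x h)

/-- The running maximum exceeds `L` for the first time at `n`. -/
def FirstExceeds (F : ℕ → G → ℝ) (L : ℝ) (n : ℕ) (x : G) : Prop :=
  L < runMax F n x ∧ ∀ i < n, runMax F i x ≤ L

theorem firstExceeds_iff_of_mem_interval {F : ℕ → G → ℝ} (hF : Martingale F ζ μ) {L : ℝ} {n : ℕ}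
    {x y : G} (h : y ∈ interval n x) : FirstExceeds F L n y ↔ FirstExceeds F L n x := by
  unfold FirstExceeds
  rw [runMax_eq_of_mem_interval hF h]
  refine and_congr_right fun _ => forall₂_congr fun i hi => ?_
  rw [runMax_eq_of_mem_interval hF (interval_anti hi.le x h)]

theorem FirstExceeds.unique {F : ℕ → G → ℝ} {L : ℝ} {m n : ℕ} {x : G}
    (hm : FirstExceeds F L m x) (hn : FirstExceeds F L n x) : m = n := by
  rcases lt_trichotomy m n with h | h | h
  · exact absurd hm.1 (not_lt.mpr (hn.2 m h))
  · exact h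
  · exact absurd hn.1 (not_lt.mpr (hm.2 n h))

theorem exists_firstExceeds {F : ℕ → G → ℝ} {L : ℝ} {j : ℕ} {x : G} (h : L < runMax F j x) :
    ∃ n ≤ j, FirstExceeds F L n x := by
  classical
  have hex : ∃ n, L < runMax F n x := ⟨j, h⟩
  exact ⟨Nat.find hex, Nat.find_min' hex h, Nat.find_spec hex,
    fun i hi => not_lt.mp (Nat.find_min hex hi)⟩

theorem firstExceeds_setOf_eq {F : ℕ → G → ℝ} (hF : Martingale F ζ μ) (L : ℝ) (n : ℕ) :
    {x | FirstExceeds F L n x} =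
      ⋃ a ∈ {a : Fin n → ZMod 2 | FirstExceeds F L n (rep n a)}, interval n (rep n a) := by
  ext x
  simp only [Set.mem_ofPred_eq, Set.mem_iUnion, exists_prop]
  constructor
  · intro h
    have hm : x ∈ interval n (rep n fun j => x j) := mem_interval_rep.mpr rfl
    exact ⟨_, (firstExceeds_iff_of_mem_interval hF hm).mp h, hm⟩
  · rintro ⟨a, ha, hm⟩
    exact (firstExceeds_iff_of_mem_interval hF hm).mpr ha

theorem measurableSet_firstExceeds {F : ℕ → G → ℝ} (hF : Martingale F ζ μ) (L : ℝ) (n : ℕ) :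
    MeasurableSet {x | FirstExceeds F L n x} := by
  rw [firstExceeds_setOf_eq hF]
  exact MeasurableSet.biUnion (Set.to_countable _) fun a _ => measurableSet_interval _ _

open Classical in
theorem sum_firstExceeds_rep {F : ℕ → G → ℝ} (hF : Martingale F ζ μ) (L : ℝ) (n : ℕ) :
    ∑ a : Fin n → ZMod 2, (if FirstExceeds F L n (rep n a) then (2⁻¹ : ℝ≥0∞) ^ n else 0) =
      μ {x | FirstExceeds F L n x} := by
  have h : {x | FirstExceeds F L n x} = ⋃ a ∈ Finset.univ.filter
      fun a : Fin n → ZMod 2 => FirstExceeds F L n (rep n a), interval n (rep n a) := by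
    rw [firstExceeds_setOf_eq hF]
    simp
  rw [h, measure_biUnion_finset, Finset.sum_filter]
  · simp only [measure_interval]
  · intro a _ b _ hab
    rw [Function.onFun, Set.disjoint_left]
    intro x ha hb
    exact hab ((mem_interval_rep.mp ha).trans (mem_interval_rep.mp hb).symm)
  · exact fun a _ => measurableSet_interval _ _

theorem measurable_maximalFunction {F : ℕ → G → ℝ} (hF : Martingale F ζ μ) :
    Measurable (maximalFunction F) := by
  refine Measurable.iSup fun n => ?_
  have := ((hF.1 n).mono (ζ.le n)).measurable
  fun_prop

theorem le_maximalFunction (F : ℕ → G → ℝ) (n : ℕ) (x : G) :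
    ENNReal.ofReal |F n x| ≤ maximalFunction F x :=
  le_iSup (fun n => ENNReal.ofReal |F n x|) n

theorem lt_childMax_of_firstExceeds {F : ℕ → G → ℝ} {L : ℝ} {n : ℕ} {x : G}
    (h : FirstExceeds F L n x) : L < childMax F n x := by
  cases n with
  | zero => exact h.1
  | succ n =>
    rcases lt_max_iff.mp h.1 with h1 | h1
    · exact absurd h1 (not_lt.mpr (h.2 n n.lt_succ_self))
    · exact h1

/-- At a first exceedance `|F (n + 1)|` is above `L` on at least one half of the interval of order
`n`. Translation by `e_n` carries the good half onto the other at the cost of the factor 2. -/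
theorem measure_firstExceeds_le {F : ℕ → G → ℝ} (hF : Martingale F ζ μ) {L : ℝ} (hL : 0 ≤ L)
    (n : ℕ) : μ {x | FirstExceeds F L n x} ≤
      2 * μ {x | FirstExceeds F L n x ∧ ENNReal.ofReal L < maximalFunction F x} := by
  set B := {x | FirstExceeds F L n x ∧ ENNReal.ofReal L < maximalFunction F x} with hB
  have hBm : MeasurableSet B := (measurableSet_firstExceeds hF L n).inter
    (measurableSet_lt measurable_const (measurable_maximalFunction hF))
  have hsub : {x | FirstExceeds F L n x} ⊆ B ∪ (fun x => x + unitVec n) ⁻¹' B := by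
    intro x hx
    have key : ∀ y, L < |F (n + 1) y| → ENNReal.ofReal L < maximalFunction F y := fun y hy =>
      ((ENNReal.ofReal_lt_ofReal_iff (hL.trans_lt hy)).mpr hy).trans_le (le_maximalFunction F _ y)
    rcases lt_max_iff.mp (lt_childMax_of_firstExceeds hx) with h | h
    · exact Or.inl ⟨hx, key _ h⟩
    · exact Or.inr ⟨(firstExceeds_iff_of_mem_interval hF
        (add_unitVec_mem_interval le_rfl x)).mpr hx, key _ h⟩
  calc _ ≤ μ B + μ ((fun x => x + unitVec n) ⁻¹' B) :=
        (measure_mono hsub).trans (measure_union_le _ _)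
    _ = 2 * μ B := by
      rw [(measurePreserving_add_const _).measure_preimage hBm.nullMeasurableSet, two_mul]

theorem sum_measure_firstExceeds_le {F : ℕ → G → ℝ} (hF : Martingale F ζ μ) {L : ℝ} (hL : 0 ≤ L)
    (N : ℕ) : ∑ n ∈ Finset.range N, μ {x | FirstExceeds F L n x} ≤
      2 * μ {x | ENNReal.ofReal L < maximalFunction F x} := by
  refine (Finset.sum_le_sum fun n _ => measure_firstExceeds_le hF hL n).trans ?_
  rw [← Finset.mul_sum]
  gcongr
  rw [← measure_biUnion_finset]
  · refine measure_mono ?_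
    intro x hx
    simp only [Set.mem_iUnion] at hx
    obtain ⟨n, _, hx⟩ := hx
    exact hx.2
  · intro m _ n _ hmn
    rw [Function.onFun, Set.disjoint_left]
    exact fun x h1 h2 => hmn (h1.1.unique h2.1)
  · exact fun n _ => (measurableSet_firstExceeds hF L n).inter
      (measurableSet_lt measurable_const (measurable_maximalFunction hF))

open Classical in
/-- The part of the difference of two stopped martingales that lives on one dyadic interval
on which the lower level is exceeded for the first time. -/
noncomputable def atom (F : ℕ → G → ℝ) (L L' : ℝ) (N n : ℕ) (a : Fin n → ZMod 2) (x : G) : ℝ :=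
  if x ∈ interval n (rep n a) ∧ FirstExceeds F L n (rep n a) then
    stopped F L' N x - stopped F L N x else 0

/-- Where `L` is not exceeded before time `N`, both stopped martingales equal `F N - F 0`; elsewhere
the time of first exceedance and the interval containing `x` are unique. -/
theorem sum_atom {F : ℕ → G → ℝ} (hF : Martingale F ζ μ) {L L' : ℝ} (h : L ≤ L') (N : ℕ) (x : G) :
    ∑ n ∈ Finset.range N, ∑ a : Fin n → ZMod 2, atom F L L' N n a x =
      stopped F L' N x - stopped F L N x := by
  classical
  have h1 : ∀ n, ∑ a : Fin n → ZMod 2, atom F L L' N n a x =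
      if FirstExceeds F L n x then stopped F L' N x - stopped F L N x else 0 := by
    intro n
    rw [Finset.sum_eq_single fun j : Fin n => x j]
    · have hm : x ∈ interval n (rep n fun j => x j) := mem_interval_rep.mpr rfl
      simp [atom, hm, firstExceeds_iff_of_mem_interval hF hm]
    · intro a _ ha
      rw [atom, if_neg]
      exact fun hx => ha (mem_interval_rep.mp hx.1)
    · simp
  simp only [h1]
  by_cases hx : ∀ j < N, runMax F j x ≤ L
  · rw [stopped_eq_sub hx, stopped_eq_sub fun j hj => (hx j hj).trans h]
    simp
  · push Not at hx
    obtain ⟨j, hj, hjx⟩ := hx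
    obtain ⟨n, hn, hnx⟩ := exists_firstExceeds hjx
    rw [Finset.sum_eq_single n, if_pos hnx]
    · exact fun m _ hm => if_neg fun h => hm (h.unique hnx)
    · intro hN
      exact absurd (Finset.mem_range.mpr (hn.trans_lt hj)) hN

theorem abs_atom_le {F : ℕ → G → ℝ} (hF : Martingale F ζ μ) {L L' : ℝ} (hL : 0 ≤ L)
    (hL' : 0 ≤ L') (N n : ℕ) (a : Fin n → ZMod 2) (x : G) :
    |atom F L L' N n a x| ≤ 2 * L' + 2 * L := by
  rw [atom]
  split_ifs
  · have := abs_sub (stopped F L' N x) (stopped F L N x)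
    linarith [abs_stopped_le hF hL N x, abs_stopped_le hF hL' N x]
  · rw [abs_zero]; positivity

theorem atom_eq_of_mem_interval {F : ℕ → G → ℝ} (hF : Martingale F ζ μ) {L L' : ℝ} {N n : ℕ}
    (hn : n ≤ N) (a : Fin n → ZMod 2) {x y : G} (h : y ∈ interval N x) :
    atom F L L' N n a y = atom F L L' N n a x := by
  have h1 : y ∈ interval n (rep n a) ↔ x ∈ interval n (rep n a) := by
    rw [mem_interval_comm, interval_eq_of_mem (interval_anti hn x h), mem_interval_comm]
  rw [atom, atom, h1, stopped_eq_of_mem_interval hF L' h, stopped_eq_of_mem_interval hF L h]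

/-- Increments before time `n` agree for both levels on the interval, since neither martingale has
stopped. Increments from time `n` on are odd under a flip of their own coordinate, and this flip
preserves the interval. -/
theorem integral_atom {F : ℕ → G → ℝ} (hF : Martingale F ζ μ) {L L' : ℝ} (hLL : L ≤ L') (N n : ℕ)
    (a : Fin n → ZMod 2) : ∫ x, atom F L L' N n a x ∂μ = 0 := by
  classical
  by_cases hE : FirstExceeds F L n (rep n a)
  swap
  · simp [atom, hE]
  have hsum : ∀ x, atom F L L' N n a x = ∑ j ∈ Finset.range N,
      if x ∈ interval n (rep n a) then stoppedIncr F L' j x - stoppedIncr F L j x else 0 := by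
    intro x
    rw [atom]
    split_ifs with h1 h2 h2
    · rw [stopped, stopped, Finset.sum_sub_distrib]
    · exact absurd h1.1 h2
    · exact absurd ⟨h2, hE⟩ h1
    · simp
  simp only [hsum]
  rw [integral_finsetSum]
  · refine Finset.sum_eq_zero fun j _ => ?_
    rcases lt_or_ge j n with hj | hj
    · refine (integral_congr_ae (Eventually.of_forall fun x => ?_)).trans (integral_zero _ _)
      split_ifs with hx
      · have h1 : runMax F j x ≤ L := by
          rw [runMax_eq_of_mem_interval hF (interval_anti hj.le _ hx)]
          exact hE.2 j hj
        simp [stoppedIncr, h1, h1.trans hLL]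
      · rfl
    · refine integral_eq_zero_of_antisymm (unitVec j) fun x => ?_
      have h1 : x + unitVec j ∈ interval n (rep n a) ↔ x ∈ interval n (rep n a) := by
        rw [mem_interval_comm, interval_eq_of_mem (add_unitVec_mem_interval hj x),
          mem_interval_comm]
      rw [h1, stoppedIncr_flip hF, stoppedIncr_flip hF]
      split_ifs
      · ring
      · simp
  · intro j _
    refine integrable_of_const_on_interval (n := max n (j + 1)) fun x y hy => ?_
    have h1 : y ∈ interval n (rep n a) ↔ x ∈ interval n (rep n a) := by
      rw [mem_interval_comm, interval_eq_of_mem (interval_anti (le_max_left _ _) x hy),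
        mem_interval_comm]
    have hy' := interval_anti (le_max_right n (j + 1)) x hy
    rw [h1, stoppedIncr_eq_of_mem_interval hF _ hy', stoppedIncr_eq_of_mem_interval hF _ hy']

/-- The factor `2^(-n)` in the atom estimate is the measure of the supporting interval, so the sum
over atoms becomes the measure of the exceedance set. -/
theorem lintegral_sqrtMaximal_stopped_sub_le {F : ℕ → G → ℝ} (hF : Martingale F ζ μ) {L L' : ℝ}
    (hL : 0 ≤ L) (hLL : L ≤ L') (N : ℕ) :
    ∫⁻ x, sqrtMaximal (fun t => stopped F L' N t - stopped F L N t) x ∂μ ≤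
      ENNReal.ofReal (30 * √(2 * L' + 2 * L)) *
        (2 * μ {x | ENNReal.ofReal L < maximalFunction F x}) := by
  classical
  have hL' := hL.trans hLL
  have hint : ∀ n ∈ Finset.range N, ∀ a, Integrable (atom F L L' N n a) μ := fun n hn a =>
    integrable_of_const_on_interval fun x y hy =>
      atom_eq_of_mem_interval hF (Finset.mem_range.mp hn).le a hy
  simp only [← sum_atom hF hLL]
  calc _ ≤ ∑ n ∈ Finset.range N, ∑ a : Fin n → ZMod 2,
        ∫⁻ x, sqrtMaximal (atom F L L' N n a) x ∂μ := by
        refine (lintegral_sqrtMaximal_sum_le _ _ fun n hn =>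
          integrable_finsetSum _ fun a _ => hint n hn a).trans ?_
        exact Finset.sum_le_sum fun n hn => lintegral_sqrtMaximal_sum_le _ _ fun a _ => hint n hn a
    _ ≤ ∑ n ∈ Finset.range N, ∑ a : Fin n → ZMod 2, ENNReal.ofReal (30 * √(2 * L' + 2 * L)) *
        (if FirstExceeds F L n (rep n a) then (2⁻¹ : ℝ≥0∞) ^ n else 0) := by
        refine Finset.sum_le_sum fun n _ => Finset.sum_le_sum fun a _ => ?_
        split_ifs with hE
        · refine (lintegral_sqrtMaximal_atom_le (M := n) (z := rep n a)
            (abs_atom_le hF hL hL' N n a) (fun x hx => if_neg fun h => hx h.1)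
            (Or.inr (integral_atom hF hLL N n a))).trans_eq ?_
          rw [ENNReal.ofReal_mul (by positivity), ENNReal.ofReal_inv_of_pos (by positivity),
            ENNReal.ofReal_pow zero_le_two, ENNReal.ofReal_ofNat, ENNReal.inv_pow]
        · have : atom F L L' N n a = fun _ => 0 := funext fun x => if_neg fun h => hE h.2
          simp [this, sqrtMaximal_zero]
    _ = ENNReal.ofReal (30 * √(2 * L' + 2 * L)) *
        ∑ n ∈ Finset.range N, μ {x | FirstExceeds F L n x} := by
        simp only [← Finset.mul_sum, sum_firstExceeds_rep hF]
    _ ≤ _ := by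
        gcongr
        exact sum_measure_firstExceeds_le hF hL N

/-! ### Summation over levels and the bounded case -/

theorem ofReal_rpow_half {a : ℝ} (ha : 0 ≤ a) :
    ENNReal.ofReal a ^ (1 / 2 : ℝ) = ENNReal.ofReal √a := by
  rw [Real.sqrt_eq_rpow, ENNReal.ofReal_rpow_of_nonneg ha (by norm_num)]

-- The active levels form an initial segment, so the geometric sum is at most twice its largest
-- term, which is below `2 √y`.
open Classical in
theorem sum_levels_le {s : ℝ} (hs : 0 < s) (b : ℕ) (y : ℝ≥0∞) :
    ∑ k ∈ Finset.range b, (if ENNReal.ofReal (4 ^ k * s ^ 2) < y then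
      ENNReal.ofReal (2 ^ k * s) else 0) ≤ 2 * y ^ (1 / 2 : ℝ) := by
  induction b with
  | zero => simp
  | succ b ih =>
    by_cases h : ENNReal.ofReal (4 ^ b * s ^ 2) < y
    · calc _ ≤ ∑ k ∈ Finset.range (b + 1), ENNReal.ofReal (2 ^ k * s) := by
            refine Finset.sum_le_sum fun k _ => ?_
            split_ifs
            · exact le_rfl
            · exact zero_le
        _ = ENNReal.ofReal (∑ k ∈ Finset.range (b + 1), 2 ^ k * s) :=
            (ENNReal.ofReal_sum_of_nonneg fun k _ => by positivity).symm
        _ ≤ ENNReal.ofReal (2 * (2 ^ b * s)) := by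
            refine ENNReal.ofReal_le_ofReal ?_
            rw [← Finset.sum_mul, ← mul_assoc, ← pow_succ']
            exact mul_le_mul_of_nonneg_right (sum_range_two_pow_le _) hs.le
        _ = 2 * ENNReal.ofReal (4 ^ b * s ^ 2) ^ (1 / 2 : ℝ) := by
            rw [ofReal_rpow_half (by positivity), ENNReal.ofReal_mul zero_le_two,
              ENNReal.ofReal_ofNat, show (4 : ℝ) ^ b * s ^ 2 = (2 ^ b * s) ^ 2 by
                rw [mul_pow, ← pow_mul, mul_comm b, pow_mul]; norm_num,
              Real.sqrt_sq (by positivity)]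
        _ ≤ _ := by gcongr
    · rw [Finset.sum_range_succ, if_neg h, add_zero]
      exact ih

/-- Telescoping over levels: `F 0` costs `30 X`, the levels above `s^2` cost `480 X`, and the part
stopped at the lowest level costs `60 s`. The free parameter `s` replaces a decomposition over
infinitely many small levels and is sent to zero at the end. -/
theorem lintegral_sqrtMaximal_martingale_le {F : ℕ → G → ℝ} (hF : Martingale F ζ μ) (N : ℕ) :
    ∫⁻ x, sqrtMaximal (F N) x ∂μ ≤ 510 * ∫⁻ x, maximalFunction F x ^ (1 / 2 : ℝ) ∂μ := by
  classical
  set X := ∫⁻ x, maximalFunction F x ^ (1 / 2 : ℝ) ∂μ with hX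
  have hmain : ∀ s : ℝ, 0 < s → ∫⁻ x, sqrtMaximal (F N) x ∂μ ≤ 510 * X + ENNReal.ofReal (60 * s) := by
    intro s hs
    obtain ⟨C, hC⟩ := exists_bound_of_const_on_interval fun x y hy =>
      runMax_eq_of_mem_interval hF (j := N) (x := x) (y := y) hy
    -- At the top level `4^b * s^2` nothing is stopped before time `N`, so the telescoping sum ends
    -- at `F N - F 0`.
    obtain ⟨b, hb⟩ : ∃ b : ℕ, C ≤ 4 ^ b * s ^ 2 := by
      obtain ⟨b, hb⟩ := pow_unbounded_of_one_lt (C / s ^ 2) (by norm_num : (1 : ℝ) < 4)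
      exact ⟨b, by rw [div_lt_iff₀ (by positivity)] at hb; exact hb.le⟩
    set L : ℕ → ℝ := fun k => 4 ^ k * s ^ 2 with hL
    have hL0 : ∀ k, 0 ≤ L k := fun k => by positivity
    have hLs : ∀ k, L (k + 1) = 4 * L k := fun k => by simp only [hL, pow_succ]; ring
    have hint : ∀ k, Integrable (stopped F (L k) N) μ := fun k =>
      integrable_of_const_on_interval fun x y hy => stopped_eq_of_mem_interval hF _ hy
    have hdec : F N = fun x => F 0 x + (stopped F (L 0) N x +
        ∑ k ∈ Finset.range b, (stopped F (L (k + 1)) N x - stopped F (L k) N x)) := by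
      funext x
      rw [Finset.sum_range_sub fun k => stopped F (L k) N x, stopped_eq_sub (L := L b)]
      · ring
      · exact fun j hj => ((runMax_mono F x hj.le).trans ((le_abs_self _).trans (hC x))).trans hb
    have h0 : ∫⁻ x, sqrtMaximal (F 0) x ∂μ ≤ 30 * X := by
      have hconst : ∀ x, |F 0 x| = |F 0 0| := fun x => by
        rw [martingale_eq_of_mem_interval hF (x := 0) (y := x) (by simp [interval])]
      refine (lintegral_sqrtMaximal_atom_le (M := 0) (z := 0) (fun x => (hconst x).le)
        (fun x hx => (hx (by simp [interval])).elim) (Or.inl rfl)).trans ?_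
      rw [pow_zero, inv_one, mul_one, ENNReal.ofReal_mul (by norm_num), ENNReal.ofReal_ofNat]
      gcongr
      calc ENNReal.ofReal √|F 0 0| = ∫⁻ _, ENNReal.ofReal √|F 0 0| ∂μ := by simp
        _ ≤ X := by
          refine lintegral_mono fun x => ?_
          rw [← ofReal_rpow_half (abs_nonneg _), ← hconst x]
          exact ENNReal.rpow_le_rpow (le_maximalFunction F 0 x) (by norm_num)
    have h1 : ∫⁻ x, sqrtMaximal (stopped F (L 0) N) x ∂μ ≤ ENNReal.ofReal (60 * s) := by
      refine (lintegral_sqrtMaximal_atom_le (M := 0) (z := 0) (abs_stopped_le hF (hL0 0) N)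
        (fun x hx => (hx (by simp [interval])).elim) (Or.inl rfl)).trans ?_
      refine ENNReal.ofReal_le_ofReal ?_
      have : √(2 * L 0) ≤ 2 * s := by
        rw [Real.sqrt_le_left (by positivity)]
        simp only [hL, pow_zero]
        nlinarith
      simp only [pow_zero, inv_one, mul_one]
      linarith
    have h2 : ∀ k, ∫⁻ x, sqrtMaximal (fun t => stopped F (L (k + 1)) N t - stopped F (L k) N t) x ∂μ ≤
        240 * ∫⁻ x, (if ENNReal.ofReal (L k) < maximalFunction F x then
          ENNReal.ofReal (2 ^ k * s) else 0) ∂μ := by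
      intro k
      refine (lintegral_sqrtMaximal_stopped_sub_le hF (hL0 k)
        (by rw [hLs]; linarith [hL0 k]) N).trans ?_
      have hm : MeasurableSet {x | ENNReal.ofReal (L k) < maximalFunction F x} :=
        measurableSet_lt measurable_const (measurable_maximalFunction hF)
      -- With ratio 4 between levels the radicand is `10 * L k ≤ 16 * L k`.
      have hsq : √(2 * L (k + 1) + 2 * L k) ≤ 4 * (2 ^ k * s) := by
        rw [Real.sqrt_le_left (by positivity), hLs]
        have : L k = (2 ^ k * s) ^ 2 := by
          simp only [hL]
          rw [mul_pow, ← pow_mul, mul_comm k, pow_mul]; norm_num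
        rw [this]
        nlinarith [sq_nonneg (2 ^ k * s)]
      have hind : ∀ x, (if ENNReal.ofReal (L k) < maximalFunction F x then
          ENNReal.ofReal (2 ^ k * s) else 0) =
          {x | ENNReal.ofReal (L k) < maximalFunction F x}.indicator
            (fun _ => ENNReal.ofReal (2 ^ k * s)) x := fun x => by
        simp [Set.indicator_apply]
      simp only [hind]
      rw [lintegral_indicator_const hm]
      simp only [← mul_assoc]
      refine mul_le_mul' ?_ le_rfl
      calc _ ≤ ENNReal.ofReal (120 * (2 ^ k * s)) * 2 :=
            mul_le_mul' (ENNReal.ofReal_le_ofReal (by linarith)) le_rfl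
        _ = 240 * ENNReal.ofReal (2 ^ k * s) := by
            rw [ENNReal.ofReal_mul (by norm_num), ENNReal.ofReal_ofNat, mul_right_comm]
            norm_num
    have hintd : ∀ k, Integrable (fun t => stopped F (L (k + 1)) N t - stopped F (L k) N t) μ :=
      fun k => (hint (k + 1)).sub (hint k)
    have hmeas : ∀ k, Measurable fun x => (if ENNReal.ofReal (L k) < maximalFunction F x then
          ENNReal.ofReal (2 ^ k * s) else 0) := fun k =>
      Measurable.ite (measurableSet_lt measurable_const (measurable_maximalFunction hF))
        measurable_const measurable_const
    have h3 : ∫⁻ x, sqrtMaximal (fun t => ∑ k ∈ Finset.range b,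
        (stopped F (L (k + 1)) N t - stopped F (L k) N t)) x ∂μ ≤ 480 * X := by
      calc _ ≤ ∑ k ∈ Finset.range b, 240 * ∫⁻ x, (if ENNReal.ofReal (L k) < maximalFunction F x then
            ENNReal.ofReal (2 ^ k * s) else 0) ∂μ :=
            (lintegral_sqrtMaximal_sum_le _ _ fun k _ => hintd k).trans
              (Finset.sum_le_sum fun k _ => h2 k)
        _ = 240 * ∫⁻ x, ∑ k ∈ Finset.range b, (if ENNReal.ofReal (L k) < maximalFunction F x then
            ENNReal.ofReal (2 ^ k * s) else 0) ∂μ := by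
            rw [← Finset.mul_sum, lintegral_finsetSum _ fun k _ => hmeas k]
        _ ≤ 240 * ∫⁻ x, 2 * maximalFunction F x ^ (1 / 2 : ℝ) ∂μ := by
            gcongr with x
            exact sum_levels_le hs b _
        _ = 480 * X := by
            rw [lintegral_const_mul _ ((measurable_maximalFunction hF).pow_const _), ← mul_assoc]
            norm_num [hX]
    rw [hdec]
    have hsumint : Integrable (fun t => ∑ k ∈ Finset.range b,
        (stopped F (L (k + 1)) N t - stopped F (L k) N t)) μ :=
      integrable_finsetSum _ fun k _ => hintd k
    calc _ ≤ ∫⁻ x, sqrtMaximal (F 0) x ∂μ + (∫⁻ x, sqrtMaximal (stopped F (L 0) N) x ∂μ +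
          ∫⁻ x, sqrtMaximal (fun t => ∑ k ∈ Finset.range b,
            (stopped F (L (k + 1)) N t - stopped F (L k) N t)) x ∂μ) :=
          (lintegral_sqrtMaximal_add_le (hF.integrable 0) ((hint 0).add hsumint)).trans
            (add_le_add le_rfl (lintegral_sqrtMaximal_add_le (hint 0) hsumint))
      _ ≤ 30 * X + (ENNReal.ofReal (60 * s) + 480 * X) := by gcongr
      _ = 510 * X + ENNReal.ofReal (60 * s) := by ring
  refine ENNReal.le_of_forall_pos_le_add fun ε hε _ => ?_
  have h := hmain (ε / 60) (by positivity)
  rwa [mul_div_cancel₀ _ (by norm_num), ENNReal.ofReal_coe_nnreal] at h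

/-- For fixed `n` the mean is computed by every `F N` with `N ≥ n`. The `liminf` form is what
Fatou's lemma needs. -/
theorem rpow_half_weightedMaximal_le_liminf {F : ℕ → G → ℝ} (hF : Martingale F ζ μ) (x : G) :
    weightedMaximal (fun n => Real.log ((n : ℝ) + 1) ^ 2) F x ^ (1 / 2 : ℝ) ≤
      liminf (fun N => sqrtMaximal (F N) x) atTop := by
  rw [one_div, ENNReal.rpow_inv_le_iff two_pos]
  refine iSup₂_le fun n hn => ?_
  rw [← ENNReal.rpow_inv_le_iff two_pos, ← one_div, ofReal_rpow_half (by positivity),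
    Real.sqrt_div (abs_nonneg _), Real.sqrt_sq (log_natCast_add_one_nonneg n)]
  refine le_liminf_of_le (by isBoundedDefault) ((eventually_ge_atTop n).mono fun N hN => ?_)
  rw [fejerMean_eq_fejerOp hF ((Nat.lt_two_pow_self (n := n)).le.trans
    (Nat.pow_le_pow_right two_pos hN))]
  exact le_iSup₂ (f := fun n (_ : n ≥ 1) =>
    ENNReal.ofReal (√|fejerOp n (F N) x| / Real.log ((n : ℝ) + 1))) n hn

theorem eLpNorm_half_eq (f : G → ℝ≥0∞) :
    eLpNorm f (1 / 2) μ = (∫⁻ x, f x ^ (1 / 2 : ℝ) ∂μ) ^ (2 : ℝ) := by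
  rw [eLpNorm_eq_lintegral_rpow_enorm_toReal (by simp) (by simp)]
  simp

theorem measurable_weightedMaximal (φ : ℕ → ℝ) (F : ℕ → G → ℝ) :
    Measurable (weightedMaximal φ F) := by
  refine Measurable.iSup fun n => Measurable.iSup fun _ => ?_
  have := measurable_fejerMean n F
  fun_prop

theorem bounded_weightedMaximal_log_sq :
    BoundedHardyToLp (1 / 2) (weightedMaximal fun n => Real.log ((n : ℝ) + 1) ^ 2) := by
  refine ⟨510 ^ 2, fun F hF => ?_⟩
  obtain ⟨hM, hH⟩ := hF
  have h : eLpNorm (weightedMaximal (fun n => Real.log ((n : ℝ) + 1) ^ 2) F) (1 / 2) μ ≤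
      ((510 ^ 2 : NNReal) : ℝ≥0∞) * hardyNorm (1 / 2) F := by
    rw [hardyNorm, eLpNorm_half_eq, eLpNorm_half_eq]
    calc _ ≤ (510 * ∫⁻ x, maximalFunction F x ^ (1 / 2 : ℝ) ∂μ) ^ (2 : ℝ) := by
          refine ENNReal.rpow_le_rpow ?_ zero_le_two
          calc _ ≤ ∫⁻ x, liminf (fun N => sqrtMaximal (F N) x) atTop ∂μ :=
                lintegral_mono fun x => rpow_half_weightedMaximal_le_liminf hM x
            _ ≤ liminf (fun N => ∫⁻ x, sqrtMaximal (F N) x ∂μ) atTop :=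
                lintegral_liminf_le fun N => measurable_sqrtMaximal (hM.integrable N)
            _ ≤ _ := (liminf_le_liminf (Eventually.of_forall fun N =>
                lintegral_sqrtMaximal_martingale_le hM N)).trans_eq (liminf_const _)
      _ = _ := by
          rw [ENNReal.mul_rpow_of_nonneg _ _ zero_le_two]
          norm_num
  exact ⟨⟨(measurable_weightedMaximal _ F).aestronglyMeasurable,
    h.trans_lt (ENNReal.mul_lt_top ENNReal.coe_lt_top hH)⟩, h⟩

/-! ### Unboundedness -/

/-- The martingale `∑_{n < N} b_n (D_{2^{n+1}} - D_{2^n})`. -/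
noncomputable def dyadicSeries (b : ℕ → ℝ) (N : ℕ) (x : G) : ℝ :=
  ∑ n ∈ Finset.range N, b n * (rademacher n x * dirichlet (2 ^ n) x)

theorem dyadicSeries_succ (b : ℕ → ℝ) (N : ℕ) (x : G) : dyadicSeries b (N + 1) x =
    dyadicSeries b N x + b N * (rademacher N x * dirichlet (2 ^ N) x) :=
  Finset.sum_range_succ _ _

theorem dirichlet_two_pow_eq_of_mem_interval {n : ℕ} {x y : G} (h : y ∈ interval n x) :
    dirichlet (2 ^ n) y = dirichlet (2 ^ n) x :=
  Finset.sum_congr rfl fun _ hi => walsh_eq_of_mem_interval (Finset.mem_range.mp hi) h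

theorem dyadicSeries_eq_of_mem_interval (b : ℕ → ℝ) {N : ℕ} {x y : G} (h : y ∈ interval N x) :
    dyadicSeries b N y = dyadicSeries b N x := by
  refine Finset.sum_congr rfl fun n hn => ?_
  have hn' := Finset.mem_range.mp hn
  rw [dirichlet_two_pow_eq_of_mem_interval (interval_anti hn'.le x h), rademacher, rademacher,
    h n hn']

theorem rademacher_add_unitVec (n : ℕ) (x : G) :
    rademacher n (x + unitVec n) = -rademacher n x := by
  have : (1 : ZMod 2).val = 1 := rfl
  rw [rademacher_add, rademacher, rademacher, unitVec_self, this]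
  ring

theorem dirichlet_two_pow_add_unitVec (n : ℕ) (x : G) :
    dirichlet (2 ^ n) (x + unitVec n) = dirichlet (2 ^ n) x :=
  dirichlet_two_pow_eq_of_mem_interval (add_unitVec_mem_interval le_rfl x)

theorem integrable_dyadicSeries (b : ℕ → ℝ) (N : ℕ) : Integrable (dyadicSeries b N) μ :=
  integrable_of_const_on_interval fun _ _ h => dyadicSeries_eq_of_mem_interval b h

theorem martingale_dyadicSeries (b : ℕ → ℝ) : Martingale (dyadicSeries b) ζ μ := by
  refine martingale_of_setIntegral_eq_succ (fun n => ?_) (integrable_dyadicSeries b) ?_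
  · exact (measurable_of_const_on_interval
      fun _ _ h => dyadicSeries_eq_of_mem_interval b h).stronglyMeasurable
  · intro n s hs
    rw [← sub_eq_zero, ← integral_sub (integrable_dyadicSeries b n).integrableOn
      (integrable_dyadicSeries b (n + 1)).integrableOn, ← integral_indicator (ζ.le n s hs)]
    refine integral_eq_zero_of_antisymm (unitVec n) fun x => ?_
    have hmem := interval_subset_of_measurableSet hs (add_unitVec_mem_interval le_rfl x)
    by_cases hx : x ∈ s
    · rw [Set.indicator_of_mem hx, Set.indicator_of_mem (hmem.mp hx), dyadicSeries_succ,
        dyadicSeries_succ, rademacher_add_unitVec, dirichlet_two_pow_add_unitVec]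
      ring
    · rw [Set.indicator_of_notMem hx, Set.indicator_of_notMem (fun h => hx (hmem.mpr h)), neg_zero]

theorem walsh_eq_one_of_mem_interval {n i : ℕ} (h : i < 2 ^ n) {x : G} (hx : x ∈ interval n 0) :
    walsh i x = 1 := by
  rw [walsh_eq_of_mem_interval h hx]
  simp [walsh, rademacher]

/-- On the block of indices from `2^n` to `2^(n+1) - 1` only the increment `n` contributes; the
earlier part is constant in the coordinate `n`, in which `w_(2^n+i)` is odd. -/
theorem fourierCoeff_dyadicSeries (b : ℕ → ℝ) {n i : ℕ} (h : i < 2 ^ n) :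
    fourierCoeff (dyadicSeries b) (2 ^ n + i) = b n := by
  classical
  rw [fourierCoeff_eq_integral (martingale_dyadicSeries b) (N := n + 1) (by rw [pow_succ]; omega)]
  have hpt : ∀ x, dyadicSeries b (n + 1) x * walsh (2 ^ n + i) x =
      dyadicSeries b n x * walsh (2 ^ n + i) x +
        b n * (interval n 0).indicator (fun _ => (2 : ℝ) ^ n) x := by
    intro x
    rw [dyadicSeries_succ, add_mul, walsh_two_pow_add h, dirichlet_two_pow]
    congr 1
    have hr : rademacher n x * rademacher n x = 1 := by
      rcases rademacher_eq_one_or n x with ⟨-, h⟩ | ⟨-, h⟩ <;> rw [h] <;> norm_num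
    by_cases hx : x ∈ interval n 0
    · rw [if_pos hx, Set.indicator_of_mem hx, walsh_eq_one_of_mem_interval h hx]
      linear_combination b n * 2 ^ n * hr
    · rw [if_neg hx, Set.indicator_of_notMem hx]
      ring
  simp only [hpt]
  rw [integral_add (integrable_mul_walsh (integrable_dyadicSeries b n) _)
    (((integrable_const _).indicator (measurableSet_interval n 0)).const_mul _),
    integral_eq_zero_of_antisymm (unitVec n), integral_const_mul,
    integral_indicator_const _ (measurableSet_interval n 0), real_interval, smul_eq_mul,
    inv_mul_cancel₀ (by positivity), mul_one, zero_add]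
  intro x
  rw [dyadicSeries_eq_of_mem_interval b (add_unitVec_mem_interval le_rfl x), walsh_two_pow_add h,
    walsh_two_pow_add h, rademacher_add_unitVec,
    walsh_eq_of_mem_interval h (add_unitVec_mem_interval le_rfl x)]
  ring

theorem fourierCoeff_dyadicSeries_zero (b : ℕ → ℝ) : fourierCoeff (dyadicSeries b) 0 = 0 := by
  rw [fourierCoeff_eq_integral (martingale_dyadicSeries b) (N := 0) (by norm_num)]
  simp [dyadicSeries]

theorem partialSum_dyadicSeries (b : ℕ → ℝ) {n j : ℕ} (h : j ≤ 2 ^ n) (x : G) :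
    partialSum (2 ^ n + j) (dyadicSeries b) x =
      partialSum (2 ^ n) (dyadicSeries b) x + b n * (rademacher n x * dirichlet j x) := by
  rw [partialSum, Finset.sum_range_add, partialSum, dirichlet, Finset.mul_sum, Finset.mul_sum]
  congr 1
  refine Finset.sum_congr rfl fun i hi => ?_
  have hi' := (Finset.mem_range.mp hi).trans_le h
  rw [fourierCoeff_dyadicSeries b hi', walsh_two_pow_add hi']

theorem abs_partialSum_dyadicSeries_le (b : ℕ → ℝ) {n i : ℕ} (h : i ≤ 2 ^ n) (x : G) :
    |partialSum i (dyadicSeries b) x| ≤ ∑ l ∈ Finset.range n, |b l| * 2 ^ l := by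
  induction n generalizing i with
  | zero =>
    have : i = 0 ∨ i = 1 := by rw [pow_zero] at h; omega
    rcases this with rfl | rfl <;> simp [partialSum, fourierCoeff_dyadicSeries_zero]
  | succ n ih =>
    rw [Finset.sum_range_succ]
    rcases le_total i (2 ^ n) with h1 | h1
    · have : 0 ≤ |b n| * 2 ^ n := by positivity
      linarith [ih h1]
    · obtain ⟨j, rfl⟩ := Nat.exists_eq_add_of_le h1
      have hj : j ≤ 2 ^ n := by rw [pow_succ] at h; omega
      rw [partialSum_dyadicSeries b hj]
      have h2 : |b n * (rademacher n x * dirichlet j x)| ≤ |b n| * 2 ^ n := by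
        rw [abs_mul, abs_mul, abs_rademacher, one_mul]
        refine mul_le_mul_of_nonneg_left ((abs_dirichlet_le j x).trans ?_) (abs_nonneg _)
        exact_mod_cast hj
      exact (abs_add_le _ _).trans (add_le_add (ih le_rfl) h2)

/-- Isolates the top block: each of the `2^n + j` partial sums in the mean differs from its block
`n` part by at most the bound for the earlier blocks. -/
theorem abs_mul_fejerSum_le (b : ℕ → ℝ) {n j : ℕ} (h : j ≤ 2 ^ n) (x : G) :
    |b n| * |fejerSum j x| ≤ (2 ^ n + j : ℕ) * (|fejerMean (2 ^ n + j) (dyadicSeries b) x| +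
      ∑ l ∈ Finset.range n, |b l| * 2 ^ l) := by
  set Λ := ∑ l ∈ Finset.range n, |b l| * 2 ^ l
  have hm : ((2 ^ n + j : ℕ) : ℝ) ≠ 0 := by positivity
  have h1 : b n * (rademacher n x * fejerSum j x) =
      (2 ^ n + j : ℕ) * fejerMean (2 ^ n + j) (dyadicSeries b) x -
        (∑ k ∈ Finset.range (2 ^ n), partialSum (k + 1) (dyadicSeries b) x +
          ∑ k ∈ Finset.range j, partialSum (2 ^ n) (dyadicSeries b) x) := by
    rw [fejerMean, ← mul_assoc ((2 ^ n + j : ℕ) : ℝ), mul_one_div_cancel hm, one_mul, sum_Icc_one_eq_sum_range,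
      Finset.sum_range_add, add_sub_add_left_eq_sub, ← Finset.sum_sub_distrib, fejerSum,
      Finset.mul_sum, Finset.mul_sum]
    refine Finset.sum_congr rfl fun k hk => ?_
    have hk' := Finset.mem_range.mp hk
    rw [add_assoc, partialSum_dyadicSeries b (by omega)]
    ring
  have h2 : |∑ k ∈ Finset.range (2 ^ n), partialSum (k + 1) (dyadicSeries b) x +
      ∑ k ∈ Finset.range j, partialSum (2 ^ n) (dyadicSeries b) x| ≤ (2 ^ n + j : ℕ) * Λ := by
    refine (abs_add_le _ _).trans ?_
    push_cast
    rw [add_mul]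
    refine add_le_add ?_ ?_
    · refine (Finset.abs_sum_le_sum_abs _ _).trans ?_
      refine (Finset.sum_le_sum fun k hk => abs_partialSum_dyadicSeries_le b (n := n)
        (Finset.mem_range.mp hk) x).trans_eq ?_
      simp [Λ]
    · refine (Finset.abs_sum_le_sum_abs _ _).trans ?_
      refine (Finset.sum_le_sum fun k _ => abs_partialSum_dyadicSeries_le b (n := n)
        le_rfl x).trans_eq ?_
      simp [Λ]
  calc |b n| * |fejerSum j x| = |b n * (rademacher n x * fejerSum j x)| := by
        rw [abs_mul, abs_mul, abs_rademacher, one_mul]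
    _ ≤ |(2 ^ n + j : ℕ) * fejerMean (2 ^ n + j) (dyadicSeries b) x| + _ := by
        rw [h1]; exact abs_sub _ _
    _ ≤ _ := by
        rw [abs_mul, Nat.abs_cast, mul_add]
        exact add_le_add le_rfl h2

/-- Here `r_k = -1`, so the factor `1 + r_k` removes the old kernel and only `2^k D_(2^k) = 4^k` is
left. -/
theorem fejerSum_two_pow_succ_eq {k : ℕ} {x : G} (hx : x ∈ interval (k + 1) (unitVec k)) :
    fejerSum (2 ^ (k + 1)) x = 4 ^ k := by
  classical
  have h1 : x ∈ interval k 0 := by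
    have := interval_anti k.le_succ _ hx
    have h0 := add_unitVec_mem_interval le_rfl (0 : G) (n := k)
    rw [zero_add] at h0
    rwa [interval_eq_of_mem h0] at this
  have h2 : rademacher k x = -1 := by
    have := hx k k.lt_succ_self
    rw [unitVec_self] at this
    rcases rademacher_eq_one_or k x with ⟨h, -⟩ | ⟨-, h⟩
    · rw [h] at this; exact absurd this (by decide)
    · exact h
  rw [fejerSum_two_pow_succ, h2, dirichlet_two_pow, if_pos h1, ← mul_pow]
  norm_num

/-- Uses the mean of order `m = 2^n + 2^(k+1)`. As `k < n`, `m ≤ 2^(n+1)`, so the weight is bounded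
by `φ (2^(n+1))` uniformly in `k`. -/
theorem ofReal_le_weightedMaximal {φ : ℕ → ℝ} (hφ : Monotone φ) (hpos : ∀ n, 1 ≤ n → 0 < φ n)
    (b : ℕ → ℝ) {n k : ℕ} (hk : k < n) {x : G} (hx : x ∈ interval (k + 1) (unitVec k)) :
    ENNReal.ofReal (√(|b n| / (2 ^ (n + 1) * φ (2 ^ (n + 1)))) * 2 ^ k) ≤
      weightedMaximal φ (dyadicSeries b) x ^ (1 / 2 : ℝ) +
        ENNReal.ofReal √((∑ l ∈ Finset.range n, |b l| * 2 ^ l) / φ 1) := by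
  set Λ := ∑ l ∈ Finset.range n, |b l| * 2 ^ l with hΛ
  have hΛ0 : 0 ≤ Λ := Finset.sum_nonneg fun l _ => by positivity
  have hj : 2 ^ (k + 1) ≤ 2 ^ n := Nat.pow_le_pow_right two_pos hk
  set m := 2 ^ n + 2 ^ (k + 1) with hm
  have hm1 : 1 ≤ m := Nat.one_le_two_pow.trans (Nat.le_add_right _ _)
  have hm2 : m ≤ 2 ^ (n + 1) := by rw [pow_succ 2 n]; omega
  have hmpos : (0 : ℝ) < m := by exact_mod_cast hm1
  have hφm := hpos m hm1
  have hφ1 := hpos 1 le_rfl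
  have h1 := abs_mul_fejerSum_le b hj x
  rw [fejerSum_two_pow_succ_eq hx, abs_of_pos (by positivity : (0 : ℝ) < 4 ^ k), ← hm, ← hΛ] at h1
  set σ := |fejerMean m (dyadicSeries b) x| with hσ
  have hσ0 : 0 ≤ σ := abs_nonneg _
  have h2 : |b n| / (2 ^ (n + 1) * φ (2 ^ (n + 1))) * 4 ^ k ≤ σ / φ m + Λ / φ 1 := by
    calc _ = |b n| * 4 ^ k / (2 ^ (n + 1) * φ (2 ^ (n + 1))) := by ring
      _ ≤ |b n| * 4 ^ k / (m * φ m) := by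
          refine div_le_div_of_nonneg_left (by positivity) (by positivity) ?_
          exact mul_le_mul (by exact_mod_cast hm2) (hφ hm2) hφm.le (by positivity)
      _ ≤ m * (σ + Λ) / (m * φ m) := div_le_div_of_nonneg_right h1 (by positivity)
      _ = σ / φ m + Λ / φ m := by rw [mul_div_mul_left _ _ hmpos.ne', add_div]
      _ ≤ _ := add_le_add le_rfl (div_le_div_of_nonneg_left hΛ0 hφ1 (hφ hm1))
  have h3 : √(|b n| / (2 ^ (n + 1) * φ (2 ^ (n + 1)))) * 2 ^ k ≤ √(σ / φ m) + √(Λ / φ 1) := by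
    have h4 : √((4 : ℝ) ^ k) = 2 ^ k := by
      rw [show (4 : ℝ) ^ k = (2 ^ k) ^ 2 by rw [← pow_mul, mul_comm, pow_mul]; norm_num,
        Real.sqrt_sq (by positivity)]
    rw [← h4, ← Real.sqrt_mul' _ (by positivity)]
    exact (Real.sqrt_le_sqrt h2).trans (sqrt_add_le_add_sqrt (by positivity) (by positivity))
  calc _ ≤ ENNReal.ofReal (√(σ / φ m) + √(Λ / φ 1)) := ENNReal.ofReal_le_ofReal h3
    _ = ENNReal.ofReal √(σ / φ m) + ENNReal.ofReal √(Λ / φ 1) :=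
        ENNReal.ofReal_add (Real.sqrt_nonneg _) (Real.sqrt_nonneg _)
    _ ≤ _ := by
        refine add_le_add ?_ le_rfl
        rw [← ofReal_rpow_half (by positivity)]
        refine ENNReal.rpow_le_rpow ?_ (by norm_num)
        exact le_iSup₂ (f := fun n (_ : n ≥ 1) =>
          ENNReal.ofReal (|fejerMean n (dyadicSeries b) x| / φ n)) m hm1

theorem disjoint_interval_unitVec {j k : ℕ} (h : j < k) :
    Disjoint (interval (j + 1) (unitVec j)) (interval (k + 1) (unitVec k)) := by
  rw [Set.disjoint_left]
  intro x h1 h2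
  have a := h1 j j.lt_succ_self
  have b := h2 j (by omega)
  rw [unitVec_self] at a
  rw [unitVec_of_ne h.ne, a] at b
  exact absurd b (by decide)

/-- The height `2^k` and the measure `2^(-k-1)` multiply to `1/2` for every `k < n`, which produces
the factor `n`. -/
theorem lintegral_weightedMaximal_ge {φ : ℕ → ℝ} (hφ : Monotone φ) (hpos : ∀ n, 1 ≤ n → 0 < φ n)
    (b : ℕ → ℝ) (n : ℕ) :
    ENNReal.ofReal (√(|b n| / (2 ^ (n + 1) * φ (2 ^ (n + 1)))) * n / 2) ≤
      ∫⁻ x, weightedMaximal φ (dyadicSeries b) x ^ (1 / 2 : ℝ) ∂μ +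
        ENNReal.ofReal √((∑ l ∈ Finset.range n, |b l| * 2 ^ l) / φ 1) := by
  set c := √(|b n| / (2 ^ (n + 1) * φ (2 ^ (n + 1)))) with hc
  set d := ENNReal.ofReal √((∑ l ∈ Finset.range n, |b l| * 2 ^ l) / φ 1) with hd
  have hc0 : 0 ≤ c := Real.sqrt_nonneg _
  set T := fun x => weightedMaximal φ (dyadicSeries b) x ^ (1 / 2 : ℝ) + d with hT
  calc ENNReal.ofReal (c * n / 2) = ∑ k ∈ Finset.range n, ENNReal.ofReal (c / 2) := by
        rw [Finset.sum_const, Finset.card_range, nsmul_eq_mul, ← ENNReal.ofReal_natCast,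
          ← ENNReal.ofReal_mul (by positivity)]
        congr 1
        ring
    _ ≤ ∑ k ∈ Finset.range n, ∫⁻ x in interval (k + 1) (unitVec k), T x ∂μ := by
        refine Finset.sum_le_sum fun k hk => ?_
        calc ENNReal.ofReal (c / 2)
            = ∫⁻ _ in interval (k + 1) (unitVec k), ENNReal.ofReal (c * 2 ^ k) ∂μ := by
              rw [setLIntegral_const, measure_interval, ← ENNReal.inv_pow, ← ENNReal.ofReal_ofNat 2,
                ← ENNReal.ofReal_pow zero_le_two, ← ENNReal.ofReal_inv_of_pos (by positivity),
                ← ENNReal.ofReal_mul (by positivity)]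
              congr 1
              rw [pow_succ]
              field_simp
          _ ≤ _ := setLIntegral_mono' (measurableSet_interval _ _) fun x hx =>
              ofReal_le_weightedMaximal hφ hpos b (Finset.mem_range.mp hk) hx
    _ = ∫⁻ x in ⋃ k ∈ Finset.range n, interval (k + 1) (unitVec k), T x ∂μ := by
        rw [lintegral_biUnion_finset]
        · intro j _ k _ hjk
          rcases lt_or_gt_of_ne hjk with h | h
          · exact disjoint_interval_unitVec h
          · exact (disjoint_interval_unitVec h).symm
        · exact fun k _ => measurableSet_interval _ _
    _ ≤ ∫⁻ x, T x ∂μ := setLIntegral_le_lintegral _ _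
    _ = _ := by
        rw [lintegral_add_left ((measurable_weightedMaximal φ _).pow_const _)]
        simp

theorem lintegral_maximalFunction_dyadicSeries_le (b : ℕ → ℝ) :
    ∫⁻ x, maximalFunction (dyadicSeries b) x ^ (1 / 2 : ℝ) ∂μ ≤
      ∑' n, ENNReal.ofReal (√(|b n| * 2 ^ n) * (2 ^ n)⁻¹) := by
  classical
  have hpt : ∀ x, maximalFunction (dyadicSeries b) x ^ (1 / 2 : ℝ) ≤
      ∑' n, (interval n 0).indicator (fun _ => ENNReal.ofReal √(|b n| * 2 ^ n)) x := by
    intro x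
    rw [one_div, ENNReal.rpow_inv_le_iff two_pos]
    refine iSup_le fun N => ?_
    rw [← ENNReal.rpow_inv_le_iff two_pos, ← one_div, ofReal_rpow_half (abs_nonneg _)]
    refine le_trans ?_ (ENNReal.sum_le_tsum (Finset.range N))
    have hD : ∀ n, 0 ≤ dirichlet (2 ^ n) x := fun n => by
      rw [dirichlet_two_pow]
      split_ifs <;> positivity
    have h1 : |dyadicSeries b N x| ≤ ∑ n ∈ Finset.range N, |b n| * dirichlet (2 ^ n) x := by
      refine (Finset.abs_sum_le_sum_abs _ _).trans_eq (Finset.sum_congr rfl fun n _ => ?_)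
      rw [abs_mul, abs_mul, abs_rademacher, one_mul, abs_of_nonneg (hD n)]
    have h0 : ∀ n, 0 ≤ |b n| * dirichlet (2 ^ n) x := fun n => mul_nonneg (abs_nonneg _) (hD n)
    calc _ ≤ ENNReal.ofReal (∑ n ∈ Finset.range N, √(|b n| * dirichlet (2 ^ n) x)) :=
          ENNReal.ofReal_le_ofReal ((Real.sqrt_le_sqrt h1).trans
            (sqrt_sum_le_sum_sqrt _ _ fun n _ => h0 n))
      _ = ∑ n ∈ Finset.range N, ENNReal.ofReal √(|b n| * dirichlet (2 ^ n) x) :=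
          ENNReal.ofReal_sum_of_nonneg fun n _ => Real.sqrt_nonneg _
      _ ≤ _ := by
          refine Finset.sum_le_sum fun n _ => ?_
          rw [dirichlet_two_pow, Set.indicator_apply]
          split_ifs <;> simp
  refine (lintegral_mono hpt).trans_eq ?_
  rw [lintegral_tsum fun n =>
    (measurable_const.indicator (measurableSet_interval n 0)).aemeasurable]
  refine tsum_congr fun n => ?_
  rw [lintegral_indicator_const (measurableSet_interval n 0), measure_interval,
    ENNReal.ofReal_mul (Real.sqrt_nonneg _), ENNReal.ofReal_inv_of_pos (by positivity),
    ENNReal.ofReal_pow zero_le_two, ENNReal.ofReal_ofNat, ENNReal.inv_pow]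

/-! ### Lacunary coefficients and the counterexample -/

theorem exists_le_sqrt_mul {φ : ℕ → ℝ} (hpos : ∀ n, 1 ≤ n → 0 < φ n)
    (hlim : Tendsto (fun n : ℕ => Real.log ((n : ℝ) + 1) ^ 2 / φ n) atTop atTop) (K : ℝ) (m : ℕ) :
    ∃ n, m < n ∧ K ≤ √(1 / φ (2 ^ (n + 1))) * n := by
  have ht : Tendsto (fun n : ℕ => 2 ^ (n + 1)) atTop atTop :=
    (tendsto_pow_atTop_atTop_of_one_lt one_lt_two).comp (tendsto_add_atTop_nat 1)
  -- For `n ≥ 2` the logarithm at `2^(n+1)` is at most `2 n`, so a ratio of `4 K^2` gives `K^2 ≤ n^2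
  -- / φ`.
  obtain ⟨n, hn, hn2⟩ := (((hlim.comp ht).eventually_ge_atTop (4 * K ^ 2)).and
    (eventually_ge_atTop (m + 2))).exists
  refine ⟨n, by omega, ?_⟩
  have hφ := hpos (2 ^ (n + 1)) Nat.one_le_two_pow
  have hn2' : (2 : ℝ) ≤ n := by exact_mod_cast (show 2 ≤ n by omega)
  simp only [Function.comp_apply] at hn
  have hlog : Real.log (((2 ^ (n + 1) : ℕ) : ℝ) + 1) ≤ 2 * n := by
    calc Real.log (((2 ^ (n + 1) : ℕ) : ℝ) + 1) ≤ Real.log (2 ^ (n + 2)) := by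
          refine Real.log_le_log (by positivity) ?_
          push_cast
          have : (1 : ℝ) ≤ 2 ^ (n + 1) := one_le_pow₀ (by norm_num)
          rw [pow_succ _ (n + 1)]
          linarith
      _ = (n + 2 : ℕ) * Real.log 2 := Real.log_pow _ _
      _ ≤ (n + 2 : ℕ) * 1 := by
          refine mul_le_mul_of_nonneg_left ?_ (by positivity)
          have := Real.log_two_lt_d9
          linarith
      _ ≤ 2 * n := by push_cast; linarith
  have h1 : K ^ 2 ≤ 1 / φ (2 ^ (n + 1)) * (n : ℝ) ^ 2 := by
    rw [le_div_iff₀ hφ] at hn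
    have h2 : Real.log (((2 ^ (n + 1) : ℕ) : ℝ) + 1) ^ 2 ≤ (2 * n) ^ 2 :=
      pow_le_pow_left₀ (log_natCast_add_one_nonneg _) hlog 2
    rw [one_div, inv_mul_eq_div, le_div_iff₀ hφ]
    nlinarith
  calc K ≤ √(K ^ 2) := by rw [Real.sqrt_sq_eq_abs]; exact le_abs_self K
    _ ≤ √(1 / φ (2 ^ (n + 1)) * (n : ℝ) ^ 2) := Real.sqrt_le_sqrt h1
    _ = _ := by rw [Real.sqrt_mul' _ (by positivity), Real.sqrt_sq (by positivity)]

theorem exists_strictMono_seq (P : ℕ → ℕ → ℕ → Prop) (h : ∀ k m, ∃ n, m < n ∧ P k m n) :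
    ∃ ν : ℕ → ℕ, StrictMono ν ∧ ∀ k, P k (ν k) (ν (k + 1)) := by
  choose f hf using h
  exact ⟨fun k => Nat.rec 0 f k, strictMono_nat_of_lt_succ fun k => (hf k _).1,
    fun k => (hf k _).2⟩

/-- Coefficients `2^{ν_k} / 4^k` at the positions `ν_k`, and zero elsewhere. -/
noncomputable def lacunaryCoeff (ν : ℕ → ℕ) : ℕ → ℝ :=
  Function.extend ν (fun k => 2 ^ ν k / 4 ^ k) 0

theorem lacunaryCoeff_apply {ν : ℕ → ℕ} (hν : StrictMono ν) (k : ℕ) :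
    lacunaryCoeff ν (ν k) = 2 ^ ν k / 4 ^ k := hν.injective.extend_apply _ _ k

theorem lacunaryCoeff_eq_zero {ν : ℕ → ℕ} {l : ℕ} (h : ∀ k, ν k ≠ l) : lacunaryCoeff ν l = 0 :=
  Function.extend_apply' _ _ _ fun ⟨k, hk⟩ => h k hk

theorem abs_lacunaryCoeff_le {ν : ℕ → ℕ} (hν : StrictMono ν) (l : ℕ) :
    |lacunaryCoeff ν l| ≤ 2 ^ l := by
  by_cases h : ∃ k, ν k = l
  · obtain ⟨k, rfl⟩ := h
    rw [lacunaryCoeff_apply hν, abs_of_nonneg (by positivity)]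
    exact div_le_self (by positivity) (one_le_pow₀ (by norm_num))
  · push Not at h
    rw [lacunaryCoeff_eq_zero h, abs_zero]
    positivity

/-- There are no coefficients strictly between `ν k` and `ν (k + 1)`, so the error bound depends on
`ν k` alone and is known before `ν (k + 1)` is chosen. -/
theorem sum_lacunaryCoeff_le {ν : ℕ → ℕ} (hν : StrictMono ν) (k : ℕ) :
    ∑ l ∈ Finset.range (ν (k + 1)), |lacunaryCoeff ν l| * 2 ^ l ≤ 4 ^ (ν k + 1) := by
  have hlt := hν k.lt_succ_self
  calc _ = ∑ l ∈ Finset.range (ν k + 1), |lacunaryCoeff ν l| * 2 ^ l := by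
        symm
        refine Finset.sum_subset (Finset.range_mono hlt) fun l hl hl' => ?_
        rw [Finset.mem_range] at hl hl'
        rw [lacunaryCoeff_eq_zero, abs_zero, zero_mul]
        rintro j rfl
        have h1 := hν.lt_iff_lt.mp hl
        have h2 : k < j := hν.lt_iff_lt.mp (by omega)
        omega
    _ ≤ ∑ l ∈ Finset.range (ν k + 1), (4 : ℝ) ^ l := by
        refine Finset.sum_le_sum fun l _ => ?_
        calc _ ≤ (2 : ℝ) ^ l * 2 ^ l :=
              mul_le_mul_of_nonneg_right (abs_lacunaryCoeff_le hν l) (by positivity)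
          _ = 4 ^ l := by rw [← mul_pow]; norm_num
    _ ≤ _ := by
        rw [geom_sum_eq (by norm_num)]
        have : (0 : ℝ) < 4 ^ (ν k + 1) := by positivity
        linarith

theorem dyadicSeries_lacunaryCoeff_mem_hardySpace {ν : ℕ → ℕ} (hν : StrictMono ν) :
    dyadicSeries (lacunaryCoeff ν) ∈ hardySpace (1 / 2) := by
  refine ⟨martingale_dyadicSeries _, ?_⟩
  rw [hardyNorm, eLpNorm_half_eq]
  refine ENNReal.rpow_lt_top_of_nonneg zero_le_two (ne_of_lt ?_)
  refine (lintegral_maximalFunction_dyadicSeries_le _).trans_lt ?_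
  -- At `ν k` the coefficient is tuned so that `√(|b| 2^n) 2^(-n) = 2^(-k)`, a summable sequence.
  have hext : (fun n => ENNReal.ofReal (√(|lacunaryCoeff ν n| * 2 ^ n) * (2 ^ n)⁻¹)) =
      Function.extend ν (fun k => (2⁻¹ : ℝ≥0∞) ^ k) 0 := by
    funext n
    by_cases h : ∃ k, ν k = n
    · obtain ⟨k, rfl⟩ := h
      rw [hν.injective.extend_apply, lacunaryCoeff_apply hν, abs_of_nonneg (by positivity)]
      have h4 : (2 : ℝ) ^ ν k / 4 ^ k * 2 ^ ν k = (2 ^ ν k / 2 ^ k) ^ 2 := by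
        rw [div_pow, ← pow_mul 2 k 2, mul_comm k 2, pow_mul 2 2 k]
        norm_num
        ring
      rw [h4, Real.sqrt_sq (by positivity), ← ENNReal.inv_pow, ← ENNReal.ofReal_ofNat 2,
        ← ENNReal.ofReal_pow zero_le_two, ← ENNReal.ofReal_inv_of_pos (by positivity)]
      congr 1
      field_simp
    · rw [Function.extend_apply' _ _ _ h, lacunaryCoeff_eq_zero fun k hk => h ⟨k, hk⟩]
      simp
  rw [hext, tsum_extend_zero hν.injective, ENNReal.tsum_geometric]
  simp

theorem exists_eLpNorm_weightedMaximal_eq_top {φ : ℕ → ℝ} (hφ : Monotone φ)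
    (hpos : ∀ n, 1 ≤ n → 0 < φ n)
    (hlim : Tendsto (fun n : ℕ => Real.log ((n : ℝ) + 1) ^ 2 / φ n) atTop atTop) :
    ∃ F ∈ hardySpace (1 / 2), eLpNorm (weightedMaximal φ F) (1 / 2) μ = ∞ := by
  -- With `n = ν (k + 1)` one has `|b_n| / 2^(n+1) = 1 / (2 * 4^(k+1))`, and the lower bound carries
  -- a further `1/2`. The threshold undoes both and leaves `k` plus the error term of the earlier
  -- blocks.
  obtain ⟨ν, hν, hP⟩ := exists_strictMono_seq
    (fun k m n => 2 * (√(2 * 4 ^ (k + 1)) * (k + √(4 ^ (m + 1) / φ 1))) ≤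
      √(1 / φ (2 ^ (n + 1))) * n)
    (fun k m => exists_le_sqrt_mul hpos hlim _ m)
  refine ⟨_, dyadicSeries_lacunaryCoeff_mem_hardySpace hν, ?_⟩
  rw [eLpNorm_half_eq]
  have hφ1 := hpos 1 le_rfl
  have key : ∀ k : ℕ, (k : ℝ≥0∞) ≤
      ∫⁻ x, weightedMaximal φ (dyadicSeries (lacunaryCoeff ν)) x ^ (1 / 2 : ℝ) ∂μ := by
    intro k
    have h := lintegral_weightedMaximal_ge hφ hpos (lacunaryCoeff ν) (ν (k + 1))
    have hφn := hpos (2 ^ (ν (k + 1) + 1)) Nat.one_le_two_pow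
    set n := ν (k + 1) with hn
    refine ENNReal.le_of_add_le_add_right (a := ENNReal.ofReal √(4 ^ (ν k + 1) / φ 1))
      ENNReal.ofReal_ne_top ?_
    calc _ = ENNReal.ofReal (k + √(4 ^ (ν k + 1) / φ 1)) := by
          rw [ENNReal.ofReal_add (by positivity) (by positivity), ENNReal.ofReal_natCast]
      _ ≤ _ := ENNReal.ofReal_le_ofReal ?_
      _ ≤ _ := h
      _ ≤ _ := by
          gcongr
          exact sum_lacunaryCoeff_le hν k
    have h1 : |lacunaryCoeff ν n| / (2 ^ (n + 1) * φ (2 ^ (n + 1))) =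
        1 / φ (2 ^ (n + 1)) / (2 * 4 ^ (k + 1)) := by
      rw [hn, lacunaryCoeff_apply hν, ← hn, abs_of_nonneg (by positivity), pow_succ 2 n]
      field_simp
    rw [h1, Real.sqrt_div (by positivity : 0 ≤ 1 / φ (2 ^ (n + 1))), div_mul_eq_mul_div, div_div,
      le_div_iff₀ (by positivity)]
    have h2 := hP k
    rw [← hn] at h2
    linarith
  have htop : ∫⁻ x, weightedMaximal φ (dyadicSeries (lacunaryCoeff ν)) x ^ (1 / 2 : ℝ) ∂μ = ∞ := by
    refine ENNReal.eq_top_of_forall_nnreal_le fun r => ?_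
    obtain ⟨k, hk⟩ := exists_nat_ge r
    exact le_trans (by exact_mod_cast hk) (key k)
  rw [htop, ENNReal.top_rpow_of_pos two_pos]

end WalshFejer

theorem corollary1 :
    WalshFejer.BoundedHardyToLp (1 / 2)
      (WalshFejer.weightedMaximal fun n => Real.log ((n : ℝ) + 1) ^ 2) ∧
    ∀ φ : ℕ → ℝ, Monotone φ → (∀ n, 1 ≤ n → 0 < φ n) →
      Tendsto (fun n : ℕ => Real.log ((n : ℝ) + 1) ^ 2 / φ n) atTop atTop →
      ¬ WalshFejer.BoundedHardyToLp (1 / 2) (WalshFejer.weightedMaximal φ) ∧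
      ∃ F ∈ WalshFejer.hardySpace (1 / 2),
        eLpNorm (WalshFejer.weightedMaximal φ F) (1 / 2) WalshFejer.μ = ∞ := by
  refine ⟨WalshFejer.bounded_weightedMaximal_log_sq, fun φ hφ hpos hlim => ?_⟩
  obtain ⟨F, hF, htop⟩ := WalshFejer.exists_eLpNorm_weightedMaximal_eq_top hφ hpos hlim
  exact ⟨fun ⟨C, hC⟩ => (hC F hF).1.2.ne htop, F, hF, htop⟩
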